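/- Let $G$ and $H$ be Hopf algebras over $\mathbb{C}$, let $\pi : G \to H$ be a surjective Hopf algebra map, and let $M = G^H = \{ g \in G : g_{(1)} \otimes \pi(g_{(2)}) = g \otimes 1 \}$ be the corresponding quantum homogeneous space. For a subspace or subalgebra $V\subseteq G$ write $V^+ = V \cap \ker \varepsilon$. Assume that $G$ is faithfully flat as a right $M$-module (the functor $G \otimes_M -$ preserves and reflects exact sequences of left $M$-modules), that $\ker \pi = M^+G$ (so that $\pi$ identifies $H$ with $G/M^+G$), and that the antipode of $H$ is bijective. Let ${}^G_M\mathcal{M}_M$ be the category of $M$-bimodules $\mathcal{E}$ with a left $G$-coaction satisfying $\Delta_L(m e m') = m_{(1)} e_{(-1)} m'_{(1)} \otimes m_{(2)} e_{(0)} m'_{(2)}$, with morphisms the $M$-bimodule maps that are left $G$-comodule maps. It is monoidal under $\otimes_M$, with coaction $e \otimes_M f \mapsto e_{(-1)} f_{(-1)} \otimes e_{(0)} \otimes_M f_{(0)}$. Let $\mathcal{M}^H_M$ be the category of right $M$-modules $V$ with a right $H$-coaction satisfying $\Delta_R(v m) = v_{(0)} m_{(2)} \otimes S(\pi(m_{(1)}))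 v_{(1)}$, with morphisms the right $M$-module maps that are right $H$-comodule maps. Let $\Phi_M : {}^G_M\mathcal{M}_M \to \mathcal{M}^H_M$ be Takeuchi's functor $\Phi_M(\mathcal{E}) = \mathcal{E}/M^+\mathcal{E}$, with right $M$-action $\overline{e}\,m = \overline{em}$ and coaction $\Delta_R(\overline{e}) = \overline{e_{(0)}} \otimes S(\pi(e_{(-1)}))$. Let ${}^G_M\mathcal{M}_0$ be the full (monoidal) subcategory of ${}^G_M\mathcal{M}_M$ of objects $\mathcal{E}$ with $\mathcal{E} M^+ \subseteq M^+ \mathcal{E}$. Let $\mathcal{M}^H_0$ be the full subcategory of $\mathcal{M}^H_M$ of objects with trivial action $v m = \varepsilon(m) v$. It is monoidal under the tensor product $\otimes$ of vector spaces, with trivial right $M$-action and coaction $v \otimes w \mapsto v_{(0)} \otimes w_{(0)} \otimes w_{(1)} v_{(1)}$. Then $\Phi_M$ restricts to an equivalence of categories between ${}^G_M\mathcal{M}_0$ and $\mathcal{M}^H_0$. Moreover, the maps $$\mu_{\mathcal{E},\mathcal{F}} : \Phi_M(\mathcal{E} \otimes_M \mathcal{F}) \to \Phi_M(\mathcal{E})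 \otimes \Phi_M(\mathcal{F}), \qquad \overline{e \otimes_M f} \mapsto \overline{e} \otimes \overline{f},$$ for $\mathcal{E},\mathcal{F}$ in ${}^G_M\mathcal{M}_0$, are well defined and are the structure isomorphisms of a (strong) monoidal functor, so that $\Phi_M$ restricts to an equivalence of monoidal categories between ${}^G_M\mathcal{M}_0$ and $\mathcal{M}^H_0$. -/

import Mathlib

open TensorProduct CategoryTheory

universe u

namespace QHS

noncomputable section

section Balanced

variable {k R A B C : Type*} [CommRing k] [AddCommGroup R] [Module k R]
  [AddCommGroup A] [Module k A] [AddCommGroup B] [Module k B] [AddCommGroup C] [Module k C]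

/-- The relations `a m ⊗ b = a ⊗ m b` for a right action `r` of `R` on `A` and a left action `l`
of `R` on `B`. -/
def balancedRel (r : R →ₗ[k] A →ₗ[k] A) (l : R →ₗ[k] B →ₗ[k] B) : Submodule k (A ⊗[k] B) :=
  Submodule.span k {x | ∃ m a b, x = r m a ⊗ₜ[k] b - a ⊗ₜ[k] l m b}

/-- The balanced tensor product `A ⊗_R B` over a (noncommutative) `k`-algebra `R`. -/
abbrev BalancedTensor (r : R →ₗ[k] A →ₗ[k] A) (l : R →ₗ[k] B →ₗ[k] B) : Type _ :=
  (A ⊗[k] B) ⧸ balancedRel r l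

namespace BalancedTensor

variable (r : R →ₗ[k] A →ₗ[k] A) (l : R →ₗ[k] B →ₗ[k] B)

/-- The class `a ⊗_R b`, as a bilinear map. -/
def mk : A →ₗ[k] B →ₗ[k] BalancedTensor r l :=
  (TensorProduct.mk k A B).compr₂ (balancedRel r l).mkQ

variable {r l}

theorem mk_balanced (m : R) (a : A) (b : B) : mk r l (r m a) b = mk r l a (l m b) := by
  have : r m a ⊗ₜ[k] b - a ⊗ₜ[k] l m b ∈ balancedRel r l :=
    Submodule.subset_span ⟨m, a, b, rfl⟩
  simpa [mk, sub_eq_zero] using (Submodule.Quotient.eq _).2 this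

/-- The universal property of `A ⊗_R B`. -/
def lift (f : A →ₗ[k] B →ₗ[k] C) (h : ∀ m a b, f (r m a) b = f a (l m b)) :
    BalancedTensor r l →ₗ[k] C :=
  (balancedRel r l).liftQ (TensorProduct.lift f) (by
    refine Submodule.span_le.2 ?_
    rintro _ ⟨m, a, b, rfl⟩
    simp [h])

@[simp] theorem lift_mk (f : A →ₗ[k] B →ₗ[k] C) (h : ∀ m a b, f (r m a) b = f a (l m b))
    (a : A) (b : B) : lift f h (mk r l a b) = f a b := by
  rfl

theorem hom_ext {f g : BalancedTensor r l →ₗ[k] C}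
    (h : ∀ a b, f (mk r l a b) = g (mk r l a b)) : f = g := by
  apply Submodule.linearMap_qext
  apply TensorProduct.ext'
  exact h

end BalancedTensor

end Balanced

section Hopf

variable {k : Type} [Field k] {G H : Type u} [Ring G] [HopfAlgebra k G] [Ring H] [HopfAlgebra k H]

/-- The algebra map `(id ⊗ π) ∘ Δ : G → G ⊗ H`, the homogeneous right coaction of `H` on `G`. -/
def homCoact (π : G →ₐc[k] H) : G →ₐ[k] G ⊗[k] H :=
  (Algebra.TensorProduct.map (AlgHom.id k G) (π : G →ₐ[k] H)).comp (Bialgebra.comulAlgHom k G)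

/-- The coinvariants `M = {g ∈ G | g₍₁₎ ⊗ π(g₍₂₎) = g ⊗ 1}`. -/
def coinv (π : G →ₐc[k] H) : Subalgebra k G :=
  AlgHom.equalizer (homCoact π) Algebra.TensorProduct.includeLeft

variable (π : G →ₐc[k] H)

/-- The inclusion `M → G`. -/
abbrev incl : coinv π →ₗ[k] G := (coinv π).val.toLinearMap

/-- The counit of `G` restricted to `M`. -/
abbrev epsM : coinv π →ₗ[k] k := (Coalgebra.counit (R := k) (A := G)).comp (incl π)

theorem incl_tensor_injective (X : Type*) [AddCommGroup X] [Module k X] :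
    Function.Injective ((incl π).lTensor X) :=
  Module.Flat.lTensor_preserves_injective_linearMap _ Subtype.val_injective

theorem coinv_prop (m : coinv π) : homCoact π (m : G) = (m : G) ⊗ₜ[k] (1 : H) := m.2

theorem homCoact_coassoc (g : G) :
    (homCoact π).toLinearMap.lTensor G (Coalgebra.comul (R := k) g) =
      TensorProduct.assoc k G G H ((Coalgebra.comul (R := k)).rTensor H (homCoact π g)) := by
  have h1 : ∀ x : G ⊗[k] G, TensorProduct.assoc k G G H ((Coalgebra.comul (R := k)).rTensor H
      (TensorProduct.map LinearMap.id (π : G →ₗ[k] H) x)) =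
      TensorProduct.map LinearMap.id (TensorProduct.map LinearMap.id (π : G →ₗ[k] H))
        (TensorProduct.assoc k G G G ((Coalgebra.comul (R := k)).rTensor G x)) := by
    intro x
    induction x with
    | zero => simp
    | add x y hx hy => simp only [map_add, hx, hy]
    | tmul a b =>
      simp only [map_tmul, LinearMap.rTensor_tmul, LinearMap.id_apply]
      generalize Coalgebra.comul (R := k) a = z
      induction z with
      | zero => simp
      | add x y hx hy => simp only [map_add, hx, hy, add_tmul]
      | tmul c d => simp
  have h2 : homCoact π g = TensorProduct.map LinearMap.id (π : G →ₗ[k] H)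
      (Coalgebra.comul (R := k) g) := rfl
  rw [h2, h1, Coalgebra.coassoc_apply]
  generalize Coalgebra.comul (R := k) g = z
  induction z with
  | zero => simp
  | add x y hx hy => simp only [map_add, hx, hy]
  | tmul c d => rfl

theorem comul_mem (m : coinv π) :
    Coalgebra.comul (R := k) (m : G) ∈ LinearMap.range ((incl π).lTensor G) := by
  let δ : G →ₗ[k] G ⊗[k] H :=
    (homCoact π).toLinearMap - (TensorProduct.mk k G H).flip 1
  have hex : Function.Exact (incl π) δ := by
    intro g
    constructor
    · intro h
      refine ⟨⟨g, ?_⟩, rfl⟩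
      exact sub_eq_zero.1 h
    · rintro ⟨m, rfl⟩
      exact sub_eq_zero.2 m.2
  have hex' := Module.Flat.lTensor_exact (M := G) hex
  refine (hex' _).1 ?_
  have h1 : ∀ x : G ⊗[k] G, (δ.lTensor G) x = (homCoact π).toLinearMap.lTensor G x -
      TensorProduct.assoc k G G H (x ⊗ₜ[k] 1) := by
    intro x
    induction x with
    | zero => simp
    | add x y hx hy => simp only [map_add, hx, hy, add_tmul]; abel
    | tmul c d => simp [δ]
  rw [h1, homCoact_coassoc, coinv_prop, LinearMap.rTensor_tmul, sub_self]

/-- The left `G`-coaction `M → G ⊗ M` obtained by restricting `Δ`. -/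
def comulM : coinv π →ₗ[k] G ⊗[k] coinv π :=
  (LinearEquiv.ofInjective _ (incl_tensor_injective π G)).symm.toLinearMap ∘ₗ
    LinearMap.codRestrict _ ((Coalgebra.comul (R := k)).comp (incl π)) (comul_mem π)

theorem incl_comulM (m : coinv π) :
    (incl π).lTensor G (comulM π m) = Coalgebra.comul (R := k) (m : G) := by
  have := LinearEquiv.apply_symm_apply (LinearEquiv.ofInjective _ (incl_tensor_injective π G))
    (LinearMap.codRestrict _ ((Coalgebra.comul (R := k)).comp (incl π)) (comul_mem π) m)
  exact congrArg Subtype.val this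

theorem comulM_one : comulM π 1 = 1 ⊗ₜ 1 := by
  apply incl_tensor_injective π G
  rw [incl_comulM]
  simp [Algebra.TensorProduct.one_def]

/-- `x ↦ (g ⊗ a, h ⊗ b) ↦ gh ⊗ f a b`. -/
abbrev mulMap {A B C : Type*} [AddCommGroup A] [Module k A] [AddCommGroup B] [Module k B]
    [AddCommGroup C] [Module k C] (f : A →ₗ[k] B →ₗ[k] C) :
    G ⊗[k] A →ₗ[k] G ⊗[k] B →ₗ[k] G ⊗[k] C :=
  TensorProduct.map₂ (LinearMap.mul k G) f

theorem comulM_mul (m n : coinv π) :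
    comulM π (m * n) = mulMap (LinearMap.mul k (coinv π)) (comulM π m) (comulM π n) := by
  apply incl_tensor_injective π G
  rw [incl_comulM]
  have h : ∀ x y : G ⊗[k] coinv π, (incl π).lTensor G (mulMap (LinearMap.mul k (coinv π)) x y) =
      (incl π).lTensor G x * (incl π).lTensor G y := by
    intro x y
    induction x with
    | zero => simp
    | add x y hx hy => simp only [map_add, LinearMap.add_apply, hx, hy, add_mul]
    | tmul a b =>
      induction y with
      | zero => simp
      | add x y hx hy => simp only [map_add, hx, hy, mul_add]
      | tmul c d => simp
  rw [h, incl_comulM, incl_comulM]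
  simp

theorem comulM_coassoc (m : coinv π) :
    TensorProduct.assoc k G G (coinv π) ((Coalgebra.comul (R := k)).rTensor _ (comulM π m)) =
      (comulM π).lTensor G (comulM π m) := by
  have hinj : Function.Injective (((incl π).lTensor G).lTensor G) :=
    Module.Flat.lTensor_preserves_injective_linearMap _ (incl_tensor_injective π G)
  apply hinj
  have h1 : ∀ x : G ⊗[k] coinv π, ((incl π).lTensor G).lTensor G
      (TensorProduct.assoc k G G (coinv π) ((Coalgebra.comul (R := k)).rTensor _ x)) =
      TensorProduct.assoc k G G G ((Coalgebra.comul (R := k)).rTensor _ ((incl π).lTensor G x)) := by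
    intro x
    induction x with
    | zero => simp
    | add x y hx hy => simp only [map_add, hx, hy]
    | tmul a b =>
      simp only [LinearMap.rTensor_tmul, LinearMap.lTensor_tmul]
      generalize Coalgebra.comul (R := k) a = z
      induction z with
      | zero => simp
      | add x y hx hy => simp only [map_add, hx, hy, add_tmul]
      | tmul c d => simp
  have h2 : ∀ x : G ⊗[k] coinv π, ((incl π).lTensor G).lTensor G ((comulM π).lTensor G x) =
      (Coalgebra.comul (R := k)).lTensor G ((incl π).lTensor G x) := by
    intro x
    induction x with
    | zero => simp
    | add x y hx hy => simp only [map_add, hx, hy]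
    | tmul a b =>
      simp only [LinearMap.lTensor_tmul, incl_comulM]
      rfl
  rw [h1, h2, incl_comulM, Coalgebra.coassoc_apply]

theorem comulM_counit (m : coinv π) :
    (Coalgebra.counit (R := k)).rTensor _ (comulM π m) = 1 ⊗ₜ[k] m := by
  apply incl_tensor_injective π k
  have h1 : ∀ x : G ⊗[k] coinv π, (incl π).lTensor k
      ((Coalgebra.counit (R := k)).rTensor _ x) =
      (Coalgebra.counit (R := k)).rTensor _ ((incl π).lTensor G x) := by
    intro x
    induction x with
    | zero => simp
    | add x y hx hy => simp only [map_add, hx, hy]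
    | tmul a b => simp
  rw [h1, incl_comulM, Coalgebra.rTensor_counit_comul]
  rfl

theorem comulM_epsM (m : coinv π) : (epsM π).lTensor G (comulM π m) = (m : G) ⊗ₜ[k] 1 := by
  rw [LinearMap.lTensor_comp, LinearMap.comp_apply, incl_comulM, Coalgebra.lTensor_counit_comul]

/-- `π(m) = ε(m) 1` for `m ∈ M`. -/
theorem pi_coinv (m : coinv π) : π (m : G) = algebraMap k H (epsM π m) := by
  have h := congrArg (TensorProduct.lid k H) (congrArg ((Coalgebra.counit (R := k)).rTensor H)
    (coinv_prop π m))
  have h1 : ∀ x : G ⊗[k] G, (Coalgebra.counit (R := k)).rTensor H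
      (TensorProduct.map LinearMap.id (π : G →ₗ[k] H) x) =
      (π : G →ₗ[k] H).lTensor k ((Coalgebra.counit (R := k)).rTensor G x) := by
    intro x
    induction x with
    | zero => simp
    | add x y hx hy => simp only [map_add, hx, hy]
    | tmul a b => simp
  have h2 : homCoact π (m : G) = TensorProduct.map LinearMap.id (π : G →ₗ[k] H)
      (Coalgebra.comul (R := k) (m : G)) := rfl
  rw [h2, h1, Coalgebra.rTensor_counit_comul] at h
  simpa [Algebra.algebraMap_eq_smul_one] using h

theorem epsM_mul (m n : coinv π) : epsM π (m * n) = epsM π m * epsM π n := by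
  simp

theorem epsM_one : epsM π 1 = 1 := by
  simp

end Hopf

section Antipode

open Coalgebra in
theorem comul_antipode {k C : Type*} [CommRing k] [Ring C] [HopfAlgebra k C] (c : C) :
    comul (R := k) (HopfAlgebra.antipode k c) =
      TensorProduct.map (HopfAlgebra.antipode k) (HopfAlgebra.antipode k)
        (TensorProduct.comm k C C (comul (R := k) c)) := by
  let S : C →ₗ[k] C := HopfAlgebra.antipode k
  let μ : C ⊗[k] C →ₗ[k] C := LinearMap.mul' k C
  let m2 : (C ⊗[k] C) ⊗[k] (C ⊗[k] C) →ₗ[k] C ⊗[k] C := LinearMap.mul' k (C ⊗[k] C)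
  let F : C →ₗ[k] C ⊗[k] C :=
    TensorProduct.map S S ∘ₗ (TensorProduct.comm k C C).toLinearMap ∘ₗ comul
  -- `S(d₁) d₂ ⊗ d₃ = 1 ⊗ d`
  have hA : ∀ d : C, m2 (TensorProduct.map ((TensorProduct.mk k C C).flip 1 ∘ₗ S) comul
      (comul (R := k) d)) = 1 ⊗ₜ d := by
    intro d
    let P : C ⊗[k] (C ⊗[k] C) →ₗ[k] C ⊗[k] C :=
      (μ ∘ₗ S.rTensor C).rTensor C ∘ₗ (TensorProduct.assoc k C C C).symm.toLinearMap
    have h1 : ∀ x : C ⊗[k] C, m2 (TensorProduct.map ((TensorProduct.mk k C C).flip 1 ∘ₗ S) comul x)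
        = P ((comul (R := k)).lTensor C x) := by
      intro x
      induction x with
      | zero => simp
      | add x y hx hy => simp only [map_add, hx, hy]
      | tmul a b =>
        simp only [TensorProduct.map_tmul, LinearMap.lTensor_tmul]
        generalize comul (R := k) b = z
        induction z with
        | zero => simp
        | add x y hx hy => simp only [map_add, hx, hy, tmul_add]
        | tmul p q => simp [m2, P, μ]
    rw [h1, ← Coalgebra.coassoc_apply]
    simp only [P, LinearMap.comp_apply, LinearEquiv.coe_coe, LinearEquiv.symm_apply_apply]
    rw [← LinearMap.comp_apply, ← LinearMap.rTensor_comp]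
    have : (μ ∘ₗ S.rTensor C) ∘ₗ comul = Algebra.linearMap k C ∘ₗ counit := by
      rw [LinearMap.comp_assoc]; exact HopfAlgebra.mul_antipode_rTensor_comul
    rw [this, LinearMap.rTensor_comp, LinearMap.comp_apply, Coalgebra.rTensor_counit_comul]
    simp
  have hB : ∀ d : C, m2 (TensorProduct.map F comul (comul (R := k) d)) =
      algebraMap k (C ⊗[k] C) (counit d) := by
    intro d
    let K : C ⊗[k] (C ⊗[k] C) →ₗ[k] C ⊗[k] C :=
      TensorProduct.lift ((LinearMap.mul k (C ⊗[k] C) ∘ₗ TensorProduct.mk k C C 1 ∘ₗ S).compl₂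
        (m2 ∘ₗ TensorProduct.map ((TensorProduct.mk k C C).flip 1 ∘ₗ S) comul))
    have h1 : ∀ x : C ⊗[k] C, m2 (TensorProduct.map F comul x)
        = K (TensorProduct.assoc k C C C ((comul (R := k)).rTensor C x)) := by
      intro x
      induction x with
      | zero => simp
      | add x y hx hy => simp only [map_add, hx, hy]
      | tmul a b =>
        simp only [TensorProduct.map_tmul, LinearMap.rTensor_tmul, F, LinearMap.comp_apply]
        generalize comul (R := k) a = z
        induction z with
        | zero => simp
        | add x y hx hy => simp only [map_add, hx, hy, add_tmul]
        | tmul p q => simp [m2, K, ← mul_assoc]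
    have h2 : ∀ x : C ⊗[k] C, K ((comul (R := k)).lTensor C x) =
        TensorProduct.mk k C C 1 (μ (S.rTensor C x)) := by
      intro x
      induction x with
      | zero => simp
      | add x y hx hy => simp only [map_add, hx, hy]
      | tmul a b => simp [K, hA, μ]
    rw [h1, Coalgebra.coassoc_apply, h2]
    have := HopfAlgebra.mul_antipode_rTensor_comul_apply (R := k) d
    rw [this, Algebra.algebraMap_eq_smul_one, Algebra.algebraMap_eq_smul_one, map_smul]
    rfl
  have hleft : WithConv.toConv F * WithConv.toConv (comul (R := k) (A := C)) = 1 := by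
    apply WithConv.ext
    ext d
    exact hB d
  have := left_inv_eq_right_inv hleft LinearMap.comul_right_inv
  exact (LinearMap.congr_fun (congrArg WithConv.ofConv this) c).symm

end Antipode

section Cats

variable {k : Type} [Field k] {G H : Type u} [Ring G] [HopfAlgebra k G] [Ring H] [HopfAlgebra k H]

/-- Objects of `^G_M M_M`: `M`-bimodules with a left `G`-coaction satisfying
`Δ(m e m') = m₍₁₎ e₍₋₁₎ m'₍₁₎ ⊗ m₍₂₎ e₍₀₎ m'₍₂₎`. -/
structure RelBimod (π : G →ₐc[k] H) : Type (u + 1) where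
  carrier : Type u
  [addCommGroup : AddCommGroup carrier]
  [module : Module k carrier]
  /-- the left action, `lact m e = m e` -/
  lact : coinv π →ₗ[k] carrier →ₗ[k] carrier
  /-- the right action, `ract m e = e m` -/
  ract : coinv π →ₗ[k] carrier →ₗ[k] carrier
  /-- the left coaction -/
  coact : carrier →ₗ[k] G ⊗[k] carrier
  lact_one : ∀ e, lact 1 e = e
  lact_mul : ∀ m n e, lact (m * n) e = lact m (lact n e)
  ract_one : ∀ e, ract 1 e = e
  ract_mul : ∀ m n e, ract (m * n) e = ract n (ract m e)
  lact_ract : ∀ m n e, lact m (ract n e) = ract n (lact m e)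
  coassoc : ∀ e, TensorProduct.assoc k G G carrier
    ((Coalgebra.comul (R := k)).rTensor carrier (coact e)) = coact.lTensor G (coact e)
  counit : ∀ e, (Coalgebra.counit (R := k)).rTensor carrier (coact e) = 1 ⊗ₜ[k] e
  compat : ∀ m n e, coact (ract n (lact m e)) =
    TensorProduct.map₂ (LinearMap.mul k G).flip ract (comulM π n)
      (TensorProduct.map₂ (LinearMap.mul k G) lact (comulM π m) (coact e))

attribute [instance] RelBimod.addCommGroup RelBimod.module

/-- Objects of `M^H_M`: right `M`-modules with a right `H`-coaction satisfying
`Δ(v m) = v₍₀₎ m₍₂₎ ⊗ S(π(m₍₁₎)) v₍₁₎`. -/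
structure RelMod (π : G →ₐc[k] H) : Type (u + 1) where
  carrier : Type u
  [addCommGroup : AddCommGroup carrier]
  [module : Module k carrier]
  /-- the right action, `ract m v = v m` -/
  ract : coinv π →ₗ[k] carrier →ₗ[k] carrier
  /-- the right coaction -/
  coact : carrier →ₗ[k] carrier ⊗[k] H
  ract_one : ∀ v, ract 1 v = v
  ract_mul : ∀ m n v, ract (m * n) v = ract n (ract m v)
  coassoc : ∀ v, TensorProduct.assoc k carrier H H (coact.rTensor H (coact v)) =
    (Coalgebra.comul (R := k)).lTensor carrier (coact v)
  counit : ∀ v, (Coalgebra.counit (R := k)).lTensor carrier (coact v) = v ⊗ₜ[k] 1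
  compat : ∀ m v, coact (ract m v) =
    TensorProduct.map₂ ract
      (LinearMap.mul k H ∘ₗ HopfAlgebra.antipode k ∘ₗ (π : G →ₗ[k] H))
      (TensorProduct.comm k G (coinv π) (comulM π m)) (coact v)

attribute [instance] RelMod.addCommGroup RelMod.module

variable {π : G →ₐc[k] H}

namespace RelBimod

theorem coact_lact (E : RelBimod π) (m : coinv π) (e : E.carrier) :
    E.coact (E.lact m e) =
      TensorProduct.map₂ (LinearMap.mul k G) E.lact (comulM π m) (E.coact e) := by
  have h := E.compat m 1 e
  rw [E.ract_one, comulM_one] at h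
  rw [h]
  generalize TensorProduct.map₂ (LinearMap.mul k G) E.lact (comulM π m) (E.coact e) = z
  induction z with
  | zero => simp
  | add x y hx hy => simp only [map_add, hx, hy]
  | tmul c d => simp [E.ract_one]

theorem coact_ract (E : RelBimod π) (m : coinv π) (e : E.carrier) :
    E.coact (E.ract m e) =
      TensorProduct.map₂ (LinearMap.mul k G).flip E.ract (comulM π m) (E.coact e) := by
  have h := E.compat 1 m e
  rw [E.lact_one, comulM_one] at h
  rw [h]
  congr 1
  generalize E.coact e = z
  induction z with
  | zero => simp
  | add x y hx hy => simp only [map_add, hx, hy]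
  | tmul c d => simp [E.lact_one]

/-- Morphisms: maps of `M`-bimodules and left `G`-comodules. -/
@[ext] structure Hom (E F : RelBimod π) where
  toLin : E.carrier →ₗ[k] F.carrier
  map_lact : ∀ m e, toLin (E.lact m e) = F.lact m (toLin e)
  map_ract : ∀ m e, toLin (E.ract m e) = F.ract m (toLin e)
  map_coact : ∀ e, F.coact (toLin e) = toLin.lTensor G (E.coact e)

instance : Category (RelBimod π) where
  Hom := Hom
  id E := ⟨LinearMap.id, fun _ _ => rfl, fun _ _ => rfl, fun _ => by simp⟩
  comp f g := ⟨g.toLin ∘ₗ f.toLin, fun m e => by simp [f.map_lact, g.map_lact],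
    fun m e => by simp [f.map_ract, g.map_ract],
    fun e => by simp [f.map_coact, g.map_coact, LinearMap.lTensor_comp]⟩

theorem hom_ext {E F : RelBimod π} {f g : E ⟶ F} (h : ∀ e, f.toLin e = g.toLin e) : f = g :=
  Hom.ext (LinearMap.ext h)

@[simp] theorem id_toLin (E : RelBimod π) : Hom.toLin (𝟙 E) = LinearMap.id := rfl

@[simp] theorem comp_toLin {E F K : RelBimod π} (f : E ⟶ F) (g : F ⟶ K) :
    Hom.toLin (f ≫ g) = g.toLin ∘ₗ f.toLin := rfl

/-- An isomorphism from a morphism with a linear inverse. -/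
def mkIso {E F : RelBimod π} (f : E ⟶ F) (g : F.carrier →ₗ[k] E.carrier)
    (hfg : ∀ e, g (f.toLin e) = e) (hgf : ∀ x, f.toLin (g x) = x) : E ≅ F where
  hom := f
  inv := ⟨g, fun m x => by
      conv_lhs => rw [← hgf x, ← f.map_lact, hfg],
    fun m x => by
      conv_lhs => rw [← hgf x, ← f.map_ract, hfg],
    fun x => by
      conv_rhs => rw [← hgf x, f.map_coact, ← LinearMap.comp_apply, ← LinearMap.lTensor_comp]
      have : g ∘ₗ f.toLin = LinearMap.id := LinearMap.ext hfg
      rw [this]; simp⟩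
  hom_inv_id := hom_ext hfg
  inv_hom_id := hom_ext hgf

/-- `M⁺ E`, the span of the products `m e` with `m ∈ M`, `ε(m) = 0`. -/
def augL (E : RelBimod π) : Submodule k E.carrier :=
  Submodule.span k {x | ∃ m e, epsM π m = 0 ∧ x = E.lact m e}

/-- `E M⁺`, the span of the products `e m` with `m ∈ M`, `ε(m) = 0`. -/
def augR (E : RelBimod π) : Submodule k E.carrier :=
  Submodule.span k {x | ∃ m e, epsM π m = 0 ∧ x = E.ract m e}

end RelBimod

namespace RelMod

/-- Morphisms: maps of right `M`-modules and right `H`-comodules. -/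
@[ext] structure Hom (V W : RelMod π) where
  toLin : V.carrier →ₗ[k] W.carrier
  map_ract : ∀ m v, toLin (V.ract m v) = W.ract m (toLin v)
  map_coact : ∀ v, W.coact (toLin v) = toLin.rTensor H (V.coact v)

instance : Category (RelMod π) where
  Hom := Hom
  id E := ⟨LinearMap.id, fun _ _ => rfl, fun _ => by simp⟩
  comp f g := ⟨g.toLin ∘ₗ f.toLin,
    fun m e => by simp [f.map_ract, g.map_ract],
    fun e => by simp [f.map_coact, g.map_coact, LinearMap.rTensor_comp]⟩

theorem hom_ext {V W : RelMod π} {f g : V ⟶ W} (h : ∀ v, f.toLin v = g.toLin v) : f = g :=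
  Hom.ext (LinearMap.ext h)

@[simp] theorem id_toLin (V : RelMod π) : Hom.toLin (𝟙 V) = LinearMap.id := rfl

@[simp] theorem comp_toLin {V W U : RelMod π} (f : V ⟶ W) (g : W ⟶ U) :
    Hom.toLin (f ≫ g) = g.toLin ∘ₗ f.toLin := rfl

/-- An isomorphism from a morphism with a linear inverse. -/
def mkIso {V W : RelMod π} (f : V ⟶ W) (g : W.carrier →ₗ[k] V.carrier)
    (hfg : ∀ e, g (f.toLin e) = e) (hgf : ∀ x, f.toLin (g x) = x) : V ≅ W where
  hom := f
  inv := ⟨g, fun m x => by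
      conv_lhs => rw [← hgf x, ← f.map_ract, hfg],
    fun x => by
      conv_rhs => rw [← hgf x, f.map_coact, ← LinearMap.comp_apply, ← LinearMap.rTensor_comp]
      have : g ∘ₗ f.toLin = LinearMap.id := LinearMap.ext hfg
      rw [this]; simp⟩
  hom_inv_id := hom_ext hfg
  inv_hom_id := hom_ext hgf

end RelMod

end Cats

section Phi

variable {k : Type} [Field k] {G H : Type u} [Ring G] [HopfAlgebra k G] [Ring H] [HopfAlgebra k H]
variable {π : G →ₐc[k] H}

namespace RelBimod

variable (E : RelBimod π)

theorem lact_mem_augL {m : coinv π} (hm : epsM π m = 0) (e : E.carrier) :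
    E.lact m e ∈ E.augL :=
  Submodule.subset_span ⟨m, e, hm, rfl⟩

theorem mkQ_lact (m : coinv π) (e : E.carrier) :
    E.augL.mkQ (E.lact m e) = epsM π m • E.augL.mkQ e := by
  have h : E.lact (m - epsM π m • 1) e ∈ E.augL := E.lact_mem_augL (by simp) e
  rw [map_sub, LinearMap.sub_apply, map_smul, LinearMap.smul_apply, E.lact_one] at h
  rw [← map_smul]
  exact (Submodule.Quotient.eq _).2 h

theorem ract_augL (m : coinv π) : E.augL ≤ E.augL.comap (E.ract m) := by
  refine Submodule.span_le.2 ?_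
  rintro _ ⟨n, e, hn, rfl⟩
  change E.ract m (E.lact n e) ∈ E.augL
  rw [← E.lact_ract]
  exact E.lact_mem_augL hn _

/-- The map `S ∘ π : G → H`. -/
abbrev antiPi (π : G →ₐc[k] H) : G →ₗ[k] H := HopfAlgebra.antipode k ∘ₗ (π : G →ₗ[k] H)

/-- `e ↦ [e₍₀₎] ⊗ S(π(e₍₋₁₎))`. -/
def preCoact : E.carrier →ₗ[k] (E.carrier ⧸ E.augL) ⊗[k] H :=
  TensorProduct.map E.augL.mkQ (antiPi π) ∘ₗ
    (TensorProduct.comm k G E.carrier).toLinearMap ∘ₗ E.coact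

theorem antiPi_mul (a b : G) : antiPi π (a * b) = antiPi π b * antiPi π a := by
  simp [HopfAlgebra.antipode_mul_antidistrib]

theorem antiPi_coinv (m : coinv π) : antiPi π (m : G) = algebraMap k H (epsM π m) := by
  simp only [antiPi, LinearMap.comp_apply]
  have : (π : G →ₗ[k] H) (m : G) = algebraMap k H (epsM π m) := pi_coinv π m
  rw [this, Algebra.algebraMap_eq_smul_one, map_smul, HopfAlgebra.antipode_one,
    Algebra.algebraMap_eq_smul_one]
  rfl

theorem preCoact_lact (m : coinv π) (e : E.carrier) :
    E.preCoact (E.lact m e) = epsM π m • E.preCoact e := by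
  simp only [preCoact, LinearMap.comp_apply, E.coact_lact]
  generalize E.coact e = x
  have h : ∀ (t : G ⊗[k] coinv π), TensorProduct.map E.augL.mkQ (antiPi π)
      ((TensorProduct.comm k G E.carrier).toLinearMap
        (TensorProduct.map₂ (LinearMap.mul k G) E.lact t x)) =
      TensorProduct.map LinearMap.id ((LinearMap.mul k H).flip
        (antiPi π (TensorProduct.rid k G ((epsM π).lTensor G t))))
      (TensorProduct.map E.augL.mkQ (antiPi π)
        ((TensorProduct.comm k G E.carrier).toLinearMap x)) := by
    intro t
    induction t with
    | zero => simp
    | add t s ht hs =>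
      simp only [map_add, LinearMap.add_apply, ht, hs, TensorProduct.map_add_right]
    | tmul a n =>
      induction x with
      | zero => simp
      | add x y hx hy => simp only [map_add, hx, hy]
      | tmul g e =>
        simp only [map₂_apply_tmul, map_tmul, LinearEquiv.coe_coe, TensorProduct.comm_tmul,
          mkQ_lact, LinearMap.mul_apply', antiPi_mul, LinearMap.lTensor_tmul,
          TensorProduct.rid_tmul, map_smul, LinearMap.smul_apply, LinearMap.flip_apply,
          LinearMap.id_apply, TensorProduct.smul_tmul, TensorProduct.tmul_smul]
  rw [h, comulM_epsM, TensorProduct.rid_tmul, one_smul, antiPi_coinv]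
  generalize (TensorProduct.map E.augL.mkQ (antiPi π)
        ((TensorProduct.comm k G E.carrier).toLinearMap x)) = z
  induction z with
  | zero => simp
  | add x y hx hy => simp only [map_add, smul_add, hx, hy]
  | tmul v h => simp [Algebra.algebraMap_eq_smul_one]

theorem preCoact_apply (e : E.carrier) : E.preCoact e =
    TensorProduct.map E.augL.mkQ (antiPi π) (TensorProduct.comm k G E.carrier (E.coact e)) := rfl

theorem preCoact_ract (m : coinv π) (e : E.carrier) :
    E.preCoact (E.ract m e) =
    TensorProduct.map₂ (LinearMap.compr₂ E.ract E.augL.mkQ)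
      (LinearMap.mul k H ∘ₗ antiPi π)
      (TensorProduct.comm k G (coinv π) (comulM π m))
      (TensorProduct.map LinearMap.id (antiPi π) (TensorProduct.comm k G E.carrier (E.coact e))) := by
  rw [preCoact_apply, E.coact_ract]
  generalize E.coact e = x
  generalize comulM π m = t
  induction t with
  | zero => simp
  | add t s ht hs => simp only [map_add, LinearMap.add_apply, ht, hs]
  | tmul a n =>
    induction x with
    | zero => simp
    | add x y hx hy => simp only [map_add, hx, hy]
    | tmul g e =>
      simp only [map₂_apply_tmul, map_tmul, TensorProduct.comm_tmul,
        LinearMap.flip_apply, LinearMap.mul_apply', antiPi_mul, LinearMap.id_apply,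
        LinearMap.compr₂_apply]
      rfl

/-- The object `Φ(E) = E / M⁺E` of `M^H_M`, with `[e] m = [e m]` and
`Δ([e]) = [e₍₀₎] ⊗ S(π(e₍₋₁₎))`. -/
def phiObj : RelMod π where
  carrier := E.carrier ⧸ E.augL
  ract :=
    { toFun := fun m => E.augL.mapQ E.augL (E.ract m) (E.ract_augL m)
      map_add' := fun m n => by
        apply Submodule.linearMap_qext; ext e; simp
      map_smul' := fun c m => by
        apply Submodule.linearMap_qext; ext e; simp }
  coact := E.augL.liftQ E.preCoact (by
    refine Submodule.span_le.2 ?_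
    rintro _ ⟨m, e, hm, rfl⟩
    change E.preCoact _ = 0
    rw [preCoact_lact, hm, zero_smul])
  ract_one := by
    intro v
    obtain ⟨e, rfl⟩ := E.augL.mkQ_surjective v
    simp [E.ract_one]
  ract_mul := by
    intro m n v
    obtain ⟨e, rfl⟩ := E.augL.mkQ_surjective v
    simp [E.ract_mul]
  coassoc := by
    intro v
    obtain ⟨e, rfl⟩ := E.augL.mkQ_surjective v
    let Θ : G ⊗[k] (G ⊗[k] E.carrier) →ₗ[k] (E.carrier ⧸ E.augL) ⊗[k] (H ⊗[k] H) :=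
      (TensorProduct.assoc k _ H H).toLinearMap ∘ₗ
        TensorProduct.map (TensorProduct.map E.augL.mkQ (antiPi π) ∘ₗ
          (TensorProduct.comm k G E.carrier).toLinearMap) (antiPi π) ∘ₗ
        (TensorProduct.comm k G (G ⊗[k] E.carrier)).toLinearMap
    have h1 : ∀ x : G ⊗[k] E.carrier, TensorProduct.assoc k _ H H
        ((E.augL.liftQ E.preCoact (by
          refine Submodule.span_le.2 ?_
          rintro _ ⟨m, e, hm, rfl⟩
          change E.preCoact _ = 0
          rw [preCoact_lact, hm, zero_smul])).rTensor H (TensorProduct.map E.augL.mkQ (antiPi π)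
            (TensorProduct.comm k G E.carrier x))) = Θ (E.coact.lTensor G x) := by
      intro x
      induction x with
      | zero => simp
      | add x y hx hy => simp only [map_add, hx, hy]
      | tmul g e => rfl
    have h2 : ∀ x : G ⊗[k] E.carrier, (Coalgebra.comul (R := k)).lTensor (E.carrier ⧸ E.augL)
        (TensorProduct.map E.augL.mkQ (antiPi π) (TensorProduct.comm k G E.carrier x)) =
        Θ (TensorProduct.assoc k G G E.carrier ((Coalgebra.comul (R := k)).rTensor _ x)) := by
      intro x
      induction x with
      | zero => simp
      | add x y hx hy => simp only [map_add, hx, hy]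
      | tmul g e =>
        have h3 : Coalgebra.comul (R := k) (antiPi π g) =
            TensorProduct.map (antiPi π) (antiPi π)
              (TensorProduct.comm k G G (Coalgebra.comul (R := k) g)) := by
          simp only [antiPi, LinearMap.comp_apply, comul_antipode]
          have h4 : Coalgebra.comul (R := k) ((π : G →ₗ[k] H) g) =
              TensorProduct.map (π : G →ₗ[k] H) (π : G →ₗ[k] H) (Coalgebra.comul (R := k) g) :=
            (CoalgHomClass.map_comp_comul_apply π g).symm
          rw [h4]
          generalize Coalgebra.comul (R := k) g = z
          induction z with
          | zero => simp
          | add x y hx hy => simp only [map_add, hx, hy]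
          | tmul c d => rfl
        simp only [TensorProduct.comm_tmul, map_tmul, LinearMap.lTensor_tmul, h3,
          LinearMap.rTensor_tmul]
        generalize Coalgebra.comul (R := k) g = z
        induction z with
        | zero => simp
        | add x y hx hy => simp only [map_add, hx, hy, add_tmul, tmul_add]
        | tmul c d => rfl
    change TensorProduct.assoc k _ H H ((E.augL.liftQ E.preCoact _).rTensor H (E.preCoact e)) =
      (Coalgebra.comul (R := k)).lTensor _ (E.preCoact e)
    refine (h1 (E.coact e)).trans ?_
    refine Eq.trans ?_ (h2 (E.coact e)).symm
    rw [E.coassoc]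
  counit := by
    intro v
    obtain ⟨e, rfl⟩ := E.augL.mkQ_surjective v
    change (Coalgebra.counit (R := k)).lTensor _ (E.preCoact e) = _
    have h : ∀ x : G ⊗[k] E.carrier, (Coalgebra.counit (R := k)).lTensor _
        (TensorProduct.map E.augL.mkQ (antiPi π) (TensorProduct.comm k G E.carrier x)) =
        TensorProduct.map E.augL.mkQ LinearMap.id (TensorProduct.comm k k E.carrier
          ((Coalgebra.counit (R := k)).rTensor _ x)) := by
      intro x
      induction x with
      | zero => simp
      | add x y hx hy => simp only [map_add, hx, hy]
      | tmul g e => simp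
    refine (h (E.coact e)).trans ?_
    rw [E.counit]
    simp
  compat := by
    intro m v
    obtain ⟨e, rfl⟩ := E.augL.mkQ_surjective v
    refine (E.preCoact_ract m e).trans ?_
    change _ = TensorProduct.map₂ _ _ _ (E.preCoact e)
    simp only [preCoact, LinearMap.comp_apply, LinearEquiv.coe_coe]
    generalize (TensorProduct.comm k G E.carrier (E.coact e)) = x
    generalize (TensorProduct.comm k G (coinv π) (comulM π m)) = t
    induction t with
    | zero => simp
    | add t s ht hs => simp only [map_add, LinearMap.add_apply, ht, hs]
    | tmul a n =>
      induction x with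
      | zero => simp
      | add x y hx hy => simp only [map_add, hx, hy]
      | tmul g e => rfl

end RelBimod

variable (π) in
/-- Takeuchi's functor `Φ_M : ^G_M M_M ⥤ M^H_M`, `E ↦ E / M⁺E`. -/
def Phi : RelBimod π ⥤ RelMod π where
  obj E := E.phiObj
  map {E F} f :=
    { toLin := E.augL.mapQ F.augL f.toLin (by
        refine Submodule.span_le.2 ?_
        rintro _ ⟨n, e, hn, rfl⟩
        change f.toLin (E.lact n e) ∈ F.augL
        rw [f.map_lact]
        exact F.lact_mem_augL hn _)
      map_ract := by
        intro m v
        obtain ⟨e, rfl⟩ := E.augL.mkQ_surjective v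
        exact congrArg F.augL.mkQ (f.map_ract m e)
      map_coact := by
        intro v
        obtain ⟨e, rfl⟩ := E.augL.mkQ_surjective v
        change F.preCoact (f.toLin e) = LinearMap.rTensor H _ (E.preCoact e)
        simp only [RelBimod.preCoact, LinearMap.comp_apply, f.map_coact, LinearEquiv.coe_coe]
        generalize E.coact e = x
        induction x with
        | zero => simp
        | add x y hx hy => simp only [map_add, hx, hy]
        | tmul g e => rfl }
  map_id E := RelMod.hom_ext fun v => by
    obtain ⟨e, rfl⟩ := E.augL.mkQ_surjective v
    rfl
  map_comp {E F K} f g := RelMod.hom_ext fun v => by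
    obtain ⟨e, rfl⟩ := E.augL.mkQ_surjective v
    rfl

end Phi

section Mon

variable {k : Type} [Field k] {G H : Type u} [Ring G] [HopfAlgebra k G] [Ring H] [HopfAlgebra k H]
variable {π : G →ₐc[k] H}

namespace RelBimod

/-- The vector space `E ⊗_M F`. -/
abbrev Tens (E F : RelBimod π) : Type u := BalancedTensor E.ract F.lact

/-- `e ⊗_M f`. -/
abbrev tmk (E F : RelBimod π) : E.carrier →ₗ[k] F.carrier →ₗ[k] Tens E F :=
  BalancedTensor.mk E.ract F.lact

theorem tmk_balanced (E F : RelBimod π) (m : coinv π) (e : E.carrier) (f : F.carrier) :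
    tmk E F (E.ract m e) f = tmk E F e (F.lact m f) :=
  BalancedTensor.mk_balanced m e f

theorem tens_induction {E F : RelBimod π} {p : Tens E F → Prop}
    (h : ∀ e f, p (tmk E F e f)) (hadd : ∀ x y, p x → p y → p (x + y)) (x : Tens E F) : p x := by
  obtain ⟨y, rfl⟩ := (balancedRel E.ract F.lact).mkQ_surjective x
  induction y with
  | zero => simpa using h 0 0
  | add x y hx hy => rw [map_add]; exact hadd _ _ hx hy
  | tmul a b => exact h a b

/-- `m (e ⊗_M f) = m e ⊗_M f`. -/
def tensLact (E F : RelBimod π) : coinv π →ₗ[k] Tens E F →ₗ[k] Tens E F where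
  toFun m := BalancedTensor.lift (tmk E F ∘ₗ E.lact m) (fun n e f => by
    simp only [LinearMap.comp_apply, E.lact_ract, tmk_balanced])
  map_add' m n := BalancedTensor.hom_ext fun e f => by simp
  map_smul' c n := BalancedTensor.hom_ext fun e f => by simp

/-- `(e ⊗_M f) m = e ⊗_M f m`. -/
def tensRact (E F : RelBimod π) : coinv π →ₗ[k] Tens E F →ₗ[k] Tens E F where
  toFun m := BalancedTensor.lift ((tmk E F).compl₂ (F.ract m)) (fun n e f => by
    simp only [LinearMap.compl₂_apply, ← F.lact_ract, tmk_balanced])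
  map_add' m n := BalancedTensor.hom_ext fun e f => by simp
  map_smul' c n := BalancedTensor.hom_ext fun e f => by simp

/-- `(g ⊗ e, h ⊗ f) ↦ gh ⊗ (e ⊗_M f)`. -/
abbrev coMul (E F : RelBimod π) : G ⊗[k] E.carrier →ₗ[k] G ⊗[k] F.carrier →ₗ[k] G ⊗[k] Tens E F :=
  TensorProduct.map₂ (LinearMap.mul k G) (tmk E F)

theorem coMul_balanced (E F : RelBimod π) (t : G ⊗[k] coinv π) (x : G ⊗[k] E.carrier)
    (y : G ⊗[k] F.carrier) :
    coMul E F (TensorProduct.map₂ (LinearMap.mul k G).flip E.ract t x) y =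
      coMul E F x (TensorProduct.map₂ (LinearMap.mul k G) F.lact t y) := by
  induction t with
  | zero => simp
  | add t s ht hs => simp only [map_add, LinearMap.add_apply, ht, hs]
  | tmul a n =>
    induction x with
    | zero => simp
    | add x y hx hy => simp only [map_add, LinearMap.add_apply, hx, hy]
    | tmul g e =>
      induction y with
      | zero => simp
      | add x y hx hy => simp only [map_add, hx, hy]
      | tmul h f => simp [tmk_balanced, mul_assoc]

/-- `e ⊗_M f ↦ e₍₋₁₎ f₍₋₁₎ ⊗ e₍₀₎ ⊗_M f₍₀₎`. -/
def tensCoact (E F : RelBimod π) : Tens E F →ₗ[k] G ⊗[k] Tens E F :=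
  BalancedTensor.lift ((coMul E F).compl₁₂ E.coact F.coact) (fun m e f => by
    simp only [LinearMap.compl₁₂_apply, E.coact_ract, F.coact_lact, coMul_balanced])

@[simp] theorem tensLact_tmk (E F : RelBimod π) (m : coinv π) (e : E.carrier) (f : F.carrier) :
    tensLact E F m (tmk E F e f) = tmk E F (E.lact m e) f := rfl

@[simp] theorem tensRact_tmk (E F : RelBimod π) (m : coinv π) (e : E.carrier) (f : F.carrier) :
    tensRact E F m (tmk E F e f) = tmk E F e (F.ract m f) := rfl

theorem tensCoact_tmk (E F : RelBimod π) (e : E.carrier) (f : F.carrier) :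
    tensCoact E F (tmk E F e f) = coMul E F (E.coact e) (F.coact f) := rfl

/-- The tensor product `E ⊗_M F` in `^G_M M_M`. -/
abbrev tens (E F : RelBimod π) : RelBimod π where
  carrier := Tens E F
  lact := tensLact E F
  ract := tensRact E F
  coact := tensCoact E F
  lact_one := tens_induction (fun e f => by simp [E.lact_one])
    (fun x y hx hy => by simp only [map_add, hx, hy])
  lact_mul m n := tens_induction (fun e f => by simp [E.lact_mul])
    (fun x y hx hy => by simp only [map_add, hx, hy])
  ract_one := tens_induction (fun e f => by simp [F.ract_one])
    (fun x y hx hy => by simp only [map_add, hx, hy])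
  ract_mul m n := tens_induction (fun e f => by simp [F.ract_mul])
    (fun x y hx hy => by simp only [map_add, hx, hy])
  lact_ract m n := tens_induction (fun e f => by simp)
    (fun x y hx hy => by simp only [map_add, hx, hy])
  coassoc := tens_induction (fun e f => by
      let B : G ⊗[k] (G ⊗[k] E.carrier) →ₗ[k] G ⊗[k] (G ⊗[k] F.carrier) →ₗ[k]
          G ⊗[k] (G ⊗[k] Tens E F) := TensorProduct.map₂ (LinearMap.mul k G) (coMul E F)
      have h1 : ∀ x y, TensorProduct.assoc k G G (Tens E F)
          ((Coalgebra.comul (R := k)).rTensor _ (coMul E F x y)) =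
          B (TensorProduct.assoc k G G _ ((Coalgebra.comul (R := k)).rTensor _ x))
            (TensorProduct.assoc k G G _ ((Coalgebra.comul (R := k)).rTensor _ y)) := by
        intro x y
        induction x with
        | zero => simp
        | add x y hx hy => simp only [map_add, LinearMap.add_apply, hx, hy]
        | tmul g e =>
          induction y with
          | zero => simp
          | add x y hx hy => simp only [map_add, hx, hy]
          | tmul h f =>
            simp only [map₂_apply_tmul, map_tmul, LinearMap.mul_apply', LinearMap.rTensor_tmul,
              Bialgebra.comul_mul]
            generalize Coalgebra.comul (R := k) g = z
            generalize Coalgebra.comul (R := k) h = w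
            induction z with
            | zero => simp
            | add x y hx hy => simp only [map_add, LinearMap.add_apply, add_mul, add_tmul, hx, hy]
            | tmul a b =>
              induction w with
              | zero => simp
              | add x y hx hy => simp only [map_add, mul_add, add_tmul, hx, hy]
              | tmul c d => simp [B]
      have h2 : ∀ x y, (tensCoact E F).lTensor G (coMul E F x y) =
          B (E.coact.lTensor G x) (F.coact.lTensor G y) := by
        intro x y
        induction x with
        | zero => simp
        | add x y hx hy => simp only [map_add, LinearMap.add_apply, hx, hy]
        | tmul g e =>
          induction y with
          | zero => simp
          | add x y hx hy => simp only [map_add, hx, hy]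
          | tmul h f => simp [B, tensCoact_tmk]
      rw [tensCoact_tmk, h1, h2, E.coassoc, F.coassoc])
    (fun x y hx hy => by simp only [map_add, hx, hy])
  counit := tens_induction (fun e f => by
      have h1 : ∀ x y, (Coalgebra.counit (R := k)).rTensor (Tens E F) (coMul E F x y) =
          TensorProduct.map₂ (LinearMap.mul k k) (tmk E F)
            ((Coalgebra.counit (R := k)).rTensor _ x) ((Coalgebra.counit (R := k)).rTensor _ y) := by
        intro x y
        induction x with
        | zero => simp
        | add x y hx hy => simp only [map_add, LinearMap.add_apply, hx, hy]
        | tmul g e =>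
          induction y with
          | zero => simp
          | add x y hx hy => simp only [map_add, hx, hy]
          | tmul h f => simp
      rw [tensCoact_tmk, h1, E.counit, F.counit]
      simp)
    (fun x y hx hy => by simp only [map_add, tmul_add, hx, hy])
  compat m n := tens_induction (fun e f => by
      rw [tensLact_tmk, tensRact_tmk, tensCoact_tmk, tensCoact_tmk, E.coact_lact, F.coact_ract]
      generalize comulM π m = s
      generalize comulM π n = t
      generalize E.coact e = x
      generalize F.coact f = y
      induction s with
      | zero => simp
      | add x y hx hy => simp only [map_add, LinearMap.add_apply, hx, hy]
      | tmul a m' =>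
      induction t with
      | zero => simp
      | add x y hx hy => simp only [map_add, LinearMap.add_apply, hx, hy]
      | tmul b n' =>
      induction x with
      | zero => simp
      | add x y hx hy => simp only [map_add, LinearMap.add_apply, hx, hy]
      | tmul g e =>
      induction y with
      | zero => simp
      | add x y hx hy => simp only [map_add, hx, hy]
      | tmul h f => simp [mul_assoc])
    (fun x y hx hy => by simp only [map_add, hx, hy])

variable (π) in
/-- The unit object `M`. -/
abbrev unitObj : RelBimod π where
  carrier := coinv π
  lact := LinearMap.mul k (coinv π)
  ract := (LinearMap.mul k (coinv π)).flip
  coact := comulM π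
  lact_one e := by simp
  lact_mul m n e := by simp [mul_assoc]
  ract_one e := by simp
  ract_mul m n e := by simp [mul_assoc]
  lact_ract m n e := by simp [mul_assoc]
  coassoc := comulM_coassoc π
  counit := comulM_counit π
  compat m n e := by
    simp only [LinearMap.flip_apply, LinearMap.mul_apply', comulM_mul]
    generalize comulM π m = s
    generalize comulM π n = t
    generalize comulM π e = x
    generalize mulMap (LinearMap.mul k (coinv π)) s x = y
    induction t with
    | zero => simp
    | add x y hx hy => simp only [map_add, LinearMap.add_apply, hx, hy]
    | tmul b n' =>
      induction y with
      | zero => simp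
      | add x y hx hy => simp only [map_add, LinearMap.add_apply, hx, hy]
      | tmul h f => simp

/-- The tensor product of two morphisms. -/
def tensMap {E E' F F' : RelBimod π} (p : E ⟶ E') (q : F ⟶ F') : tens E F ⟶ tens E' F' where
  toLin := BalancedTensor.lift ((tmk E' F').compl₁₂ p.toLin q.toLin) (fun m e f => by
    simp only [LinearMap.compl₁₂_apply, p.map_ract, q.map_lact, tmk_balanced])
  map_lact m := tens_induction
    (fun e f => congrArg (fun z => tmk E' F' z (q.toLin f)) (p.map_lact m e))
    (fun x y hx hy => by simp only [map_add, hx, hy])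
  map_ract m := tens_induction
    (fun e f => congrArg (fun z => tmk E' F' (p.toLin e) z) (q.map_ract m f))
    (fun x y hx hy => by simp only [map_add, hx, hy])
  map_coact := tens_induction (fun e f => by
      refine (tensCoact_tmk E' F' (p.toLin e) (q.toLin f)).trans ?_
      refine Eq.trans ?_ (congrArg (LinearMap.lTensor G _) (tensCoact_tmk E F e f)).symm
      rw [p.map_coact, q.map_coact]
      generalize E.coact e = x
      generalize F.coact f = y
      induction x with
      | zero => simp
      | add x y hx hy => simp only [map_add, LinearMap.add_apply, hx, hy]
      | tmul g e =>
        induction y with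
        | zero => simp
        | add x y hx hy => simp only [map_add, hx, hy]
        | tmul h f => rfl)
    (fun x y hx hy => by simp only [map_add, hx, hy])

/-- The linear map `(e ⊗ f) ⊗ l ↦ e ⊗ (f ⊗ l)`. -/
def assocLin (E F K : RelBimod π) : Tens (tens E F) K →ₗ[k] Tens E (tens F K) :=
  BalancedTensor.lift
    (BalancedTensor.lift
      (LinearMap.mk₂ k (fun (e : E.carrier) (f : F.carrier) =>
          (tmk E (tens F K) e) ∘ₗ (tmk F K f))
        (fun e e' f => by ext; simp) (fun c e f => by ext; simp)
        (fun e f f' => by ext; simp) (fun c e f => by ext; simp))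
      (fun m e f => by
        ext l
        exact tmk_balanced E (tens F K) m e (tmk F K f l)))
    (fun m x l => by
      revert x
      refine tens_induction (fun e f => ?_) (fun x y hx hy => ?_)
      · exact congrArg (tmk E (tens F K) e) (tmk_balanced F K m f l)
      · simp only [map_add, LinearMap.add_apply, hx, hy])

/-- The linear map `e ⊗ (f ⊗ l) ↦ (e ⊗ f) ⊗ l`. -/
def assocInv (E F K : RelBimod π) : Tens E (tens F K) →ₗ[k] Tens (tens E F) K :=
  BalancedTensor.lift
    (LinearMap.flip (BalancedTensor.lift
      (LinearMap.mk₂ k (fun (f : F.carrier) (l : K.carrier) =>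
          ((tmk (tens E F) K).flip l) ∘ₗ ((tmk E F).flip f))
        (fun e e' f => by ext; simp) (fun c e f => by ext; simp)
        (fun e f f' => by ext; simp) (fun c e f => by ext; simp))
      (fun m f l => by
        ext e
        exact tmk_balanced (tens E F) K m (tmk E F e f) l)))
    (fun m e x => by
      revert x
      refine tens_induction (fun f l => ?_) (fun x y hx hy => ?_)
      · exact congrArg (fun z => tmk (tens E F) K z l) (tmk_balanced E F m e f)
      · simp only [map_add, hx, hy])

theorem tens_induction₃ {E F K : RelBimod π} {p : Tens (tens E F) K → Prop}
    (h : ∀ e f l, p (tmk (tens E F) K (tmk E F e f) l))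
    (hadd : ∀ x y, p x → p y → p (x + y)) : ∀ x, p x := by
  refine tens_induction (fun x l => ?_) hadd
  revert x
  refine tens_induction (fun e f => h e f l) (fun x y hx hy => ?_)
  have := hadd _ _ hx hy
  rwa [← LinearMap.add_apply, ← map_add] at this

theorem tens_induction₃' {E F K : RelBimod π} {p : Tens E (tens F K) → Prop}
    (h : ∀ e f l, p (tmk E (tens F K) e (tmk F K f l)))
    (hadd : ∀ x y, p x → p y → p (x + y)) : ∀ x, p x := by
  refine tens_induction (fun e x => ?_) hadd
  revert x
  refine tens_induction (fun f l => h e f l) (fun x y hx hy => ?_)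
  have := hadd _ _ hx hy
  rwa [← map_add] at this

theorem tens_induction₄ {E F K L : RelBimod π} {p : Tens (tens (tens E F) K) L → Prop}
    (h : ∀ e f l n, p (tmk (tens (tens E F) K) L (tmk (tens E F) K (tmk E F e f) l) n))
    (hadd : ∀ x y, p x → p y → p (x + y)) : ∀ x, p x := by
  refine tens_induction (fun x n => ?_) hadd
  revert x
  refine tens_induction₃ (fun e f l => h e f l n) (fun x y hx hy => ?_)
  have := hadd _ _ hx hy
  rwa [← LinearMap.add_apply, ← map_add] at this

/-- The associator `(E ⊗_M F) ⊗_M K ≅ E ⊗_M (F ⊗_M K)`. -/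
def assocIso (E F K : RelBimod π) : tens (tens E F) K ≅ tens E (tens F K) :=
  mkIso
    { toLin := assocLin E F K
      map_lact := fun m => tens_induction₃ (fun e f l => rfl)
        (fun x y hx hy => by simp only [map_add, hx, hy])
      map_ract := fun m => tens_induction₃ (fun e f l => rfl)
        (fun x y hx hy => by simp only [map_add, hx, hy])
      map_coact := tens_induction₃ (fun e f l => by
          change coMul E (tens F K) (E.coact e) (coMul F K (F.coact f) (K.coact l)) =
            (assocLin E F K).lTensor G
              (coMul (tens E F) K (coMul E F (E.coact e) (F.coact f)) (K.coact l))
          generalize E.coact e = x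
          generalize F.coact f = y
          generalize K.coact l = z
          induction x with
          | zero => simp
          | add x y hx hy => simp only [map_add, LinearMap.add_apply, hx, hy]
          | tmul g e =>
          induction y with
          | zero => simp
          | add x y hx hy => simp only [map_add, LinearMap.add_apply, hx, hy]
          | tmul h f =>
          induction z with
          | zero => simp
          | add x y hx hy => simp only [map_add, hx, hy]
          | tmul i l =>
            simp only [map₂_apply_tmul, map_tmul, LinearMap.mul_apply', LinearMap.lTensor_tmul,
              mul_assoc]
            rfl)
        (fun x y hx hy => by simp only [map_add, hx, hy]) }
    (assocInv E F K)
    (tens_induction₃ (fun e f l => rfl) (fun x y hx hy => by simp only [map_add, hx, hy]))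
    (tens_induction₃' (fun e f l => rfl) (fun x y hx hy => by simp only [map_add, hx, hy]))

/-- The left unitor `M ⊗_M E ≅ E`, `m ⊗ e ↦ m e`. -/
def leftIso (E : RelBimod π) : tens (unitObj π) E ≅ E :=
  mkIso
    { toLin := BalancedTensor.lift E.lact (fun m n e => E.lact_mul n m e)
      map_lact := fun m => tens_induction (fun n e => E.lact_mul m n e)
        (fun x y hx hy => by simp only [map_add, hx, hy])
      map_ract := fun m => tens_induction (fun n e => E.lact_ract n m e)
        (fun x y hx hy => by simp only [map_add, hx, hy])
      map_coact := tens_induction (fun n e => by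
          refine (E.coact_lact n e).trans ?_
          refine Eq.trans ?_
            (congrArg (LinearMap.lTensor G _) (tensCoact_tmk (unitObj π) E n e)).symm
          change _ = LinearMap.lTensor G _ (coMul (unitObj π) E (comulM π n) (E.coact e))
          generalize comulM π n = t
          generalize E.coact e = x
          induction t with
          | zero => simp
          | add x y hx hy => simp only [map_add, LinearMap.add_apply, hx, hy]
          | tmul a m =>
            induction x with
            | zero => simp
            | add x y hx hy => simp only [map_add, hx, hy]
            | tmul g e => rfl)
        (fun x y hx hy => by simp only [map_add, hx, hy]) }
    (tmk (unitObj π) E (1 : coinv π))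
    (tens_induction (fun n e => by
        change tmk (unitObj π) E (1 : coinv π) (E.lact n e) = _
        rw [← tmk_balanced]
        exact congrArg (fun z => tmk (unitObj π) E z e) (one_mul n))
      (fun x y hx hy => by simp only [map_add, hx, hy]))
    (fun e => E.lact_one e)

/-- The right unitor `E ⊗_M M ≅ E`, `e ⊗ m ↦ e m`. -/
def rightIso (E : RelBimod π) : tens E (unitObj π) ≅ E :=
  mkIso
    { toLin := BalancedTensor.lift E.ract.flip (fun m e n => (E.ract_mul m n e).symm)
      map_lact := fun m => tens_induction (fun e n => (E.lact_ract m n e).symm)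
        (fun x y hx hy => by simp only [map_add, hx, hy])
      map_ract := fun m => tens_induction (fun e n => E.ract_mul n m e)
        (fun x y hx hy => by simp only [map_add, hx, hy])
      map_coact := tens_induction (fun e n => by
          refine (E.coact_ract n e).trans ?_
          refine Eq.trans ?_
            (congrArg (LinearMap.lTensor G _) (tensCoact_tmk E (unitObj π) e n)).symm
          change _ = LinearMap.lTensor G _ (coMul E (unitObj π) (E.coact e) (comulM π n))
          generalize comulM π n = t
          generalize E.coact e = x
          induction t with
          | zero => simp
          | add x y hx hy => simp only [map_add, LinearMap.add_apply, hx, hy]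
          | tmul a m =>
            induction x with
            | zero => simp
            | add x y hx hy => simp only [map_add, LinearMap.add_apply, hx, hy]
            | tmul g e => rfl)
        (fun x y hx hy => by simp only [map_add, hx, hy]) }
    ((tmk E (unitObj π)).flip (1 : coinv π))
    (tens_induction (fun e n => by
        change tmk E (unitObj π) (E.ract n e) (1 : coinv π) = _
        rw [tmk_balanced]
        exact congrArg (tmk E (unitObj π) e) (mul_one n))
      (fun x y hx hy => by simp only [map_add, hx, hy]))
    (fun e => E.ract_one e)

instance : MonoidalCategoryStruct (RelBimod π) where
  tensorObj := tens
  whiskerLeft E _ _ q := tensMap (𝟙 E) q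
  whiskerRight p F := tensMap p (𝟙 F)
  tensorHom := tensMap
  tensorUnit := unitObj π
  associator := assocIso
  leftUnitor := leftIso
  rightUnitor := rightIso

/-- The monoidal category `(^G_M M_M, ⊗_M)`. -/
instance : MonoidalCategory (RelBimod π) := MonoidalCategory.ofTensorHom
  (id_tensorHom_id := fun _ _ => hom_ext <| tens_induction (fun _ _ => rfl)
    (fun x y hx hy => by simp only [map_add, hx, hy]))
  (id_tensorHom := fun _ _ _ _ => rfl)
  (tensorHom_id := fun _ _ => rfl)
  (tensorHom_comp_tensorHom := fun _ _ _ _ => hom_ext <| tens_induction (fun _ _ => rfl)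
    (fun x y hx hy => by simp only [map_add, hx, hy]))
  (associator_naturality := fun _ _ _ => hom_ext <| tens_induction₃ (fun _ _ _ => rfl)
    (fun x y hx hy => by simp only [map_add, hx, hy]))
  (leftUnitor_naturality := fun f => hom_ext <| tens_induction
    (fun n e => (f.map_lact n e).symm)
    (fun x y hx hy => by simp only [map_add, hx, hy]))
  (rightUnitor_naturality := fun f => hom_ext <| tens_induction
    (fun e n => (f.map_ract n e).symm)
    (fun x y hx hy => by simp only [map_add, hx, hy]))
  (pentagon := fun _ _ _ _ => hom_ext <| tens_induction₄ (fun _ _ _ _ => rfl)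
    (fun x y hx hy => by simp only [map_add, hx, hy]))
  (triangle := fun E F => hom_ext <| tens_induction₃ (fun e n f =>
      (tmk_balanced E F n e f).symm)
    (fun x y hx hy => by simp only [map_add, hx, hy]))

end RelBimod

end Mon

section Main

variable {k : Type} [Field k] {G H : Type u} [Ring G] [HopfAlgebra k G] [Ring H] [HopfAlgebra k H]

/-- The objects `E` of `^G_M M_M` with `E M⁺ ⊆ M⁺ E`; they span the full subcategory `^G_M M_0`. -/
def isM0 (π : G →ₐc[k] H) : ObjectProperty (RelBimod π) := fun E => E.augR ≤ E.augL

/-- The objects `V` of `M^H_M` with trivial action `v m = ε(m) v`; they span the full subcategory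
`M^H_0`. -/
def isTrivial (π : G →ₐc[k] H) : ObjectProperty (RelMod π) :=
  fun V => ∀ m v, V.ract m v = epsM π m • v

variable {π : G →ₐc[k] H}

instance : (isM0 π).IsMonoidal where
  prop_unit := by
    refine Submodule.span_le.2 ?_
    rintro _ ⟨m, e, hm, rfl⟩
    obtain ⟨n, rfl⟩ : ∃ n : coinv π, n = e := ⟨e, rfl⟩
    refine Submodule.subset_span ⟨n * m, (1 : coinv π), ?_, ?_⟩
    · rw [epsM_mul, hm, mul_zero]
    · exact (mul_one (n * m)).symm
  prop_tensor E F hE hF := by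
    refine Submodule.span_le.2 ?_
    rintro _ ⟨m, x, hm, rfl⟩
    change RelBimod.tensRact E F m x ∈ (RelBimod.tens E F).augL
    revert x
    refine RelBimod.tens_induction (fun e f => ?_) (fun x y hx hy => ?_)
    · rw [RelBimod.tensRact_tmk]
      have h1 : F.ract m f ∈ F.augL := hF (Submodule.subset_span ⟨m, f, hm, rfl⟩)
      have h2 : F.augL ≤ (RelBimod.tens E F).augL.comap (RelBimod.tmk E F e) := by
        refine Submodule.span_le.2 ?_
        rintro _ ⟨n, f, hn, rfl⟩
        change RelBimod.tmk E F e (F.lact n f) ∈ (RelBimod.tens E F).augL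
        rw [← RelBimod.tmk_balanced]
        have h3 : E.ract n e ∈ E.augL := hE (Submodule.subset_span ⟨n, e, hn, rfl⟩)
        have h4 : E.augL ≤ (RelBimod.tens E F).augL.comap ((RelBimod.tmk E F).flip f) := by
          refine Submodule.span_le.2 ?_
          rintro _ ⟨p, e, hp, rfl⟩
          exact Submodule.subset_span ⟨p, RelBimod.tmk E F e f, hp, rfl⟩
        exact h4 h3
      exact h2 h1
    · rw [map_add]
      exact add_mem hx hy

namespace RelMod

/-- The trivial right action `v m = ε(m) v`. -/
def trivRact (π : G →ₐc[k] H) (X : Type u) [AddCommGroup X] [Module k X] :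
    coinv π →ₗ[k] X →ₗ[k] X :=
  LinearMap.lsmul k X ∘ₗ epsM π

@[simp] theorem trivRact_apply (X : Type u) [AddCommGroup X] [Module k X] (m : coinv π) (x : X) :
    trivRact π X m x = epsM π m • x := rfl

theorem triv_compat (X : Type u) [AddCommGroup X] [Module k X] (m : coinv π) (z : X ⊗[k] H) :
    TensorProduct.map₂ (trivRact π X)
      (LinearMap.mul k H ∘ₗ HopfAlgebra.antipode k ∘ₗ (π : G →ₗ[k] H))
      (TensorProduct.comm k G (coinv π) (comulM π m)) z = epsM π m • z := by
  have h : ∀ t : G ⊗[k] coinv π, TensorProduct.map₂ (trivRact π X)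
      (LinearMap.mul k H ∘ₗ RelBimod.antiPi π)
      (TensorProduct.comm k G (coinv π) t) z =
      TensorProduct.map LinearMap.id (LinearMap.mul k H
        (RelBimod.antiPi π (TensorProduct.rid k G ((epsM π).lTensor G t)))) z := by
    intro t
    induction t with
    | zero => simp
    | add t s ht hs =>
      simp only [map_add, LinearMap.add_apply, ht, hs, TensorProduct.map_add_right]
    | tmul a n =>
      induction z with
      | zero => simp
      | add x y hx hy => simp only [map_add, hx, hy]
      | tmul g e =>
        simp only [map₂_apply_tmul, map_tmul, TensorProduct.comm_tmul, trivRact_apply,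
          LinearMap.mul_apply', LinearMap.lTensor_tmul, LinearMap.comp_apply (f := LinearMap.mul k H),
          TensorProduct.rid_tmul, map_smul, LinearMap.smul_apply,
          LinearMap.id_apply, TensorProduct.smul_tmul, TensorProduct.tmul_smul]
  refine (h _).trans ?_
  rw [comulM_epsM, TensorProduct.rid_tmul, one_smul, RelBimod.antiPi_coinv]
  clear h
  induction z with
  | zero => simp
  | add x y hx hy => simp only [map_add, smul_add, hx, hy]
  | tmul v h => simp [Algebra.algebraMap_eq_smul_one]

/-- `(v ⊗ h, w ⊗ h') ↦ (v ⊗ w) ⊗ h' h`. -/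
abbrev coMul (V W : RelMod π) : V.carrier ⊗[k] H →ₗ[k] W.carrier ⊗[k] H →ₗ[k]
    (V.carrier ⊗[k] W.carrier) ⊗[k] H :=
  TensorProduct.map₂ (TensorProduct.mk k V.carrier W.carrier) (LinearMap.mul k H).flip

/-- `v ⊗ w ↦ v₍₀₎ ⊗ w₍₀₎ ⊗ w₍₁₎ v₍₁₎`. -/
def tensCoact (V W : RelMod π) :
    V.carrier ⊗[k] W.carrier →ₗ[k] (V.carrier ⊗[k] W.carrier) ⊗[k] H :=
  TensorProduct.lift ((coMul V W).compl₁₂ V.coact W.coact)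

theorem tensCoact_tmul (V W : RelMod π) (v : V.carrier) (w : W.carrier) :
    tensCoact V W (v ⊗ₜ w) = coMul V W (V.coact v) (W.coact w) := rfl

/-- The tensor product of the underlying comodules, with the trivial right `M`-action. -/
abbrev tens (V W : RelMod π) : RelMod π where
  carrier := V.carrier ⊗[k] W.carrier
  ract := trivRact π _
  coact := tensCoact V W
  ract_one v := by simp
  ract_mul m n v := by simp only [trivRact_apply, epsM_mul, mul_smul, smul_comm (epsM π m)]
  coassoc z := by
    let B : V.carrier ⊗[k] (H ⊗[k] H) →ₗ[k] W.carrier ⊗[k] (H ⊗[k] H) →ₗ[k]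
        (V.carrier ⊗[k] W.carrier) ⊗[k] (H ⊗[k] H) :=
      TensorProduct.map₂ (TensorProduct.mk k V.carrier W.carrier) (LinearMap.mul k (H ⊗[k] H)).flip
    have h1 : ∀ x y, TensorProduct.assoc k _ H H ((tensCoact V W).rTensor H (coMul V W x y)) =
        B (TensorProduct.assoc k _ H H (V.coact.rTensor H x))
          (TensorProduct.assoc k _ H H (W.coact.rTensor H y)) := by
      intro x y
      induction x with
      | zero => simp
      | add x y hx hy => simp only [map_add, LinearMap.add_apply, hx, hy]
      | tmul v g =>
      induction y with
      | zero => simp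
      | add x y hx hy => simp only [map_add, hx, hy]
      | tmul w h =>
        simp only [map₂_apply_tmul, map_tmul, LinearMap.flip_apply, LinearMap.mul_apply',
          LinearMap.rTensor_tmul, TensorProduct.mk_apply, tensCoact_tmul]
        generalize V.coact v = x
        generalize W.coact w = y
        induction x with
        | zero => simp
        | add x y hx hy => simp only [map_add, LinearMap.add_apply, add_tmul, hx, hy]
        | tmul v g' =>
        induction y with
        | zero => simp
        | add x y hx hy => simp only [map_add, add_tmul, hx, hy]
        | tmul w h' => simp [B]
    have h2 : ∀ x y, (Coalgebra.comul (R := k)).lTensor _ (coMul V W x y) =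
        B ((Coalgebra.comul (R := k)).lTensor _ x) ((Coalgebra.comul (R := k)).lTensor _ y) := by
      intro x y
      induction x with
      | zero => simp
      | add x y hx hy => simp only [map_add, LinearMap.add_apply, hx, hy]
      | tmul v g =>
      induction y with
      | zero => simp
      | add x y hx hy => simp only [map_add, hx, hy]
      | tmul w h => simp [B]
    induction z with
    | zero => simp
    | add x y hx hy => simp only [map_add, hx, hy]
    | tmul v w => rw [tensCoact_tmul, h1, h2, V.coassoc, W.coassoc]
  counit z := by
    have h1 : ∀ x y, (Coalgebra.counit (R := k)).lTensor _ (coMul V W x y) =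
        TensorProduct.map₂ (TensorProduct.mk k V.carrier W.carrier) (LinearMap.mul k k)
          ((Coalgebra.counit (R := k)).lTensor _ x) ((Coalgebra.counit (R := k)).lTensor _ y) := by
      intro x y
      induction x with
      | zero => simp
      | add x y hx hy => simp only [map_add, LinearMap.add_apply, hx, hy]
      | tmul v g =>
      induction y with
      | zero => simp
      | add x y hx hy => simp only [map_add, hx, hy]
      | tmul w h => simp [mul_comm]
    induction z with
    | zero => simp
    | add x y hx hy => simp only [map_add, add_tmul, hx, hy]
    | tmul v w =>
      rw [tensCoact_tmul, h1, V.counit, W.counit]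
      simp
  compat m z := by rw [triv_compat, trivRact_apply, map_smul]

variable (π) in
/-- The unit object: the ground field with trivial action and coaction. -/
abbrev unitObj : RelMod π where
  carrier := ULift.{u} k
  ract := trivRact π _
  coact := (TensorProduct.mk k (ULift.{u} k) H).flip 1
  ract_one v := by simp
  ract_mul m n v := by simp only [trivRact_apply, epsM_mul, mul_smul, smul_comm (epsM π m)]
  coassoc v := by simp [Algebra.TensorProduct.one_def]
  counit v := by simp
  compat m v := by rw [triv_compat, trivRact_apply, map_smul]

/-- The tensor product of two comodule maps. -/
def tensMap {V V' W W' : RelMod π} (p : V ⟶ V') (q : W ⟶ W') : tens V W ⟶ tens V' W' where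
  toLin := TensorProduct.map p.toLin q.toLin
  map_ract m z := by simp
  map_coact := fun (z : V.carrier ⊗[k] W.carrier) => by
    induction z with
    | zero => simp
    | add x y hx hy => simp only [map_add, hx, hy]
    | tmul v w =>
      rw [map_tmul, tensCoact_tmul, tensCoact_tmul, p.map_coact, q.map_coact]
      generalize V.coact v = x
      generalize W.coact w = y
      induction x with
      | zero => simp
      | add x y hx hy => simp only [map_add, LinearMap.add_apply, hx, hy]
      | tmul v g =>
      induction y with
      | zero => simp
      | add x y hx hy => simp only [map_add, hx, hy]
      | tmul w h => simp

/-- The associator of vector spaces. -/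
def assocIso (V W U : RelMod π) : tens (tens V W) U ≅ tens V (tens W U) :=
  mkIso
    { toLin := (TensorProduct.assoc k V.carrier W.carrier U.carrier).toLinearMap
      map_ract := fun m z => by simp
      map_coact := fun (z : (V.carrier ⊗[k] W.carrier) ⊗[k] U.carrier) => by
        have h : ∀ x y z, coMul V (tens W U) x (coMul W U y z) =
            (TensorProduct.assoc k V.carrier W.carrier U.carrier).toLinearMap.rTensor H
              (coMul (tens V W) U (coMul V W x y) z) := by
          intro x y z
          induction x with
          | zero => simp
          | add x y hx hy => simp only [map_add, LinearMap.add_apply, hx, hy]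
          | tmul v g =>
          induction y with
          | zero => simp
          | add x y hx hy => simp only [map_add, LinearMap.add_apply, hx, hy]
          | tmul w h =>
          induction z with
          | zero => simp
          | add x y hx hy => simp only [map_add, hx, hy]
          | tmul u i => simp [mul_assoc]
        induction z with
        | zero => simp
        | add x y hx hy => simp only [map_add, hx, hy]
        | tmul z u =>
          induction z with
          | zero => simp
          | add x y hx hy => simp only [map_add, add_tmul, hx, hy]
          | tmul v w => exact h _ _ _ }
    (TensorProduct.assoc k V.carrier W.carrier U.carrier).symm.toLinearMap
    (fun z => LinearEquiv.symm_apply_apply _ z) (fun z => LinearEquiv.apply_symm_apply _ z)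

/-- The left unitor `k ⊗ V ≅ V` for `V` with trivial action. -/
def leftIso (V : RelMod π) (hV : isTrivial π V) : tens (unitObj π) V ≅ V :=
  let e := (TensorProduct.congr (ULift.moduleEquiv (R := k) (M := k))
    (LinearEquiv.refl k V.carrier)).trans (TensorProduct.lid k V.carrier)
  mkIso
    { toLin := e.toLinearMap
      map_ract := fun m z => by
        rw [trivRact_apply, map_smul, hV]
      map_coact := fun (z : ULift.{u} k ⊗[k] V.carrier) => by
        induction z with
        | zero => simp
        | add x y hx hy => simp only [map_add, hx, hy]
        | tmul c v =>
          have h : ∀ x : V.carrier ⊗[k] H, c.down • x =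
              e.toLinearMap.rTensor H (coMul (unitObj π) V (c ⊗ₜ 1) x) := by
            intro x
            induction x with
            | zero => simp
            | add x y hx hy => simp only [map_add, smul_add, hx, hy]
            | tmul v g => simp [e, TensorProduct.smul_tmul']
          rw [tensCoact_tmul]
          refine Eq.trans ?_ (h (V.coact v))
          simp [e] }
    e.symm.toLinearMap
    (fun z => LinearEquiv.symm_apply_apply _ z) (fun z => LinearEquiv.apply_symm_apply _ z)

/-- The right unitor `V ⊗ k ≅ V` for `V` with trivial action. -/
def rightIso (V : RelMod π) (hV : isTrivial π V) : tens V (unitObj π) ≅ V :=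
  let e := (TensorProduct.congr (LinearEquiv.refl k V.carrier)
    (ULift.moduleEquiv (R := k) (M := k))).trans (TensorProduct.rid k V.carrier)
  mkIso
    { toLin := e.toLinearMap
      map_ract := fun m z => by
        rw [trivRact_apply, map_smul, hV]
      map_coact := fun (z : V.carrier ⊗[k] ULift.{u} k) => by
        induction z with
        | zero => simp
        | add x y hx hy => simp only [map_add, hx, hy]
        | tmul v c =>
          have h : ∀ x : V.carrier ⊗[k] H, c.down • x =
              e.toLinearMap.rTensor H (coMul V (unitObj π) x (c ⊗ₜ 1)) := by
            intro x
            induction x with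
            | zero => simp
            | add x y hx hy => simp only [map_add, LinearMap.add_apply, smul_add, hx, hy]
            | tmul v g => simp [e, TensorProduct.smul_tmul']
          rw [tensCoact_tmul]
          refine Eq.trans ?_ (h (V.coact v))
          simp [e] }
    e.symm.toLinearMap
    (fun z => LinearEquiv.symm_apply_apply _ z) (fun z => LinearEquiv.apply_symm_apply _ z)

theorem tens_isTrivial (V W : RelMod π) : isTrivial π (tens V W) := fun _ _ => rfl

theorem unitObj_isTrivial : isTrivial π (unitObj π) := fun _ _ => rfl

instance : MonoidalCategoryStruct (isTrivial π).FullSubcategory where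
  tensorObj V W := ⟨tens V.obj W.obj, tens_isTrivial _ _⟩
  whiskerLeft V _ _ q := ObjectProperty.homMk (tensMap (𝟙 V.obj) q.hom)
  whiskerRight p W := ObjectProperty.homMk (tensMap p.hom (𝟙 W.obj))
  tensorHom p q := ObjectProperty.homMk (tensMap p.hom q.hom)
  tensorUnit := ⟨unitObj π, unitObj_isTrivial⟩
  associator V W U := (isTrivial π).isoMk (assocIso V.obj W.obj U.obj)
  leftUnitor V := (isTrivial π).isoMk (leftIso V.obj V.property)
  rightUnitor V := (isTrivial π).isoMk (rightIso V.obj V.property)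

theorem sub_ext {V W : (isTrivial π).FullSubcategory} {f g : V ⟶ W}
    (h : f.hom.toLin = g.hom.toLin) : f = g :=
  InducedCategory.hom_ext (Hom.ext h)

/-- The monoidal category `(M^H_0, ⊗)`. -/
instance : MonoidalCategory (isTrivial π).FullSubcategory := MonoidalCategory.ofTensorHom
  (id_tensorHom_id := fun _ _ => sub_ext <| TensorProduct.ext' fun _ _ => rfl)
  (id_tensorHom := fun _ _ _ _ => rfl)
  (tensorHom_id := fun _ _ => rfl)
  (tensorHom_comp_tensorHom := fun _ _ _ _ => sub_ext <| TensorProduct.ext' fun _ _ => rfl)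
  (associator_naturality := fun _ _ _ => sub_ext <| TensorProduct.ext_threefold
    fun _ _ _ => rfl)
  (leftUnitor_naturality := fun f => sub_ext <| TensorProduct.ext'
    fun c v => (f.hom.toLin.map_smul c.down v).symm)
  (rightUnitor_naturality := fun f => sub_ext <| TensorProduct.ext'
    fun v c => (f.hom.toLin.map_smul c.down v).symm)
  (pentagon := fun _ _ _ _ => sub_ext <| TensorProduct.ext_fourfold fun _ _ _ _ => rfl)
  (triangle := fun _ _ => sub_ext <| TensorProduct.ext_threefold
    fun v c w => (TensorProduct.smul_tmul c.down v w).symm)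

end RelMod

end Main

section Hyp

variable {k : Type} [Field k] {G H : Type u} [Ring G] [HopfAlgebra k G] [Ring H] [HopfAlgebra k H]

/-- The right `M`-module structure of `G`. -/
def rightMulG (π : G →ₐc[k] H) : coinv π →ₗ[k] G →ₗ[k] G :=
  (LinearMap.mul k G).flip ∘ₗ incl π

/-- The map `G ⊗_M f : G ⊗_M X → G ⊗_M Y` for a map `f` of left `M`-modules. -/
def baseMap (π : G →ₐc[k] H) {X Y : Type u}
    [AddCommGroup X] [Module k X] [Module (coinv π) X] [IsScalarTower k (coinv π) X]
    [AddCommGroup Y] [Module k Y] [Module (coinv π) Y] [IsScalarTower k (coinv π) Y]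
    (f : X →ₗ[coinv π] Y) :
    BalancedTensor (rightMulG π) (Algebra.lsmul k k X).toLinearMap →ₗ[k]
      BalancedTensor (rightMulG π) (Algebra.lsmul k k Y).toLinearMap :=
  BalancedTensor.lift
    ((BalancedTensor.mk (rightMulG π) (Algebra.lsmul k k Y).toLinearMap).compl₂
      (f.restrictScalars k))
    (fun m g x => by
      simp only [LinearMap.compl₂_apply, BalancedTensor.mk_balanced]
      congr 1
      exact (f.map_smul m x).symm)

/-- `G` is a faithfully flat right `M`-module: `G ⊗_M -` preserves and reflects exact sequences
of left `M`-modules. -/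
def IsFaithfullyFlat (π : G →ₐc[k] H) : Prop :=
  ∀ (X Y Z : Type u)
    [AddCommGroup X] [Module k X] [Module (coinv π) X] [IsScalarTower k (coinv π) X]
    [AddCommGroup Y] [Module k Y] [Module (coinv π) Y] [IsScalarTower k (coinv π) Y]
    [AddCommGroup Z] [Module k Z] [Module (coinv π) Z] [IsScalarTower k (coinv π) Z]
    (f : X →ₗ[coinv π] Y) (g : Y →ₗ[coinv π] Z),
    Function.Exact f g ↔ Function.Exact (baseMap π f) (baseMap π g)

/-- `M⁺ G`, the span of the products `m g` with `m ∈ M`, `ε(m) = 0` and `g ∈ G`. -/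
def augG (π : G →ₐc[k] H) : Submodule k G :=
  Submodule.span k {x | ∃ (m : coinv π) (g : G), epsM π m = 0 ∧ x = m * g}

variable {π : G →ₐc[k] H}

/-- The class `[e] ∈ Φ(E)` of `e ∈ E`. -/
def phiClass (E : RelBimod π) : E.carrier →ₗ[k] ((Phi π).obj E).carrier := E.augL.mkQ

/-- The functor `^G_M M_0 ⥤ M^H_0` to which `Φ_M` restricts, when it sends the objects of the first
subcategory to objects of the second. -/
abbrev PhiRestr (h : isM0 π ≤ (isTrivial π).inverseImage (Phi π)) :
    (isM0 π).FullSubcategory ⥤ (isTrivial π).FullSubcategory :=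
  (isTrivial π).lift ((isM0 π).ι ⋙ Phi π) (fun E => h E.obj E.property)

end Hyp

end

end QHS

/-! Everything rests on the isomorphism `baseEquiv`: the map `g ⊗_M e ↦ g e₍₋₁₎ ⊗ [e₍₀₎]` identifies
`G ⊗_M E` with `G ⊗ Φ(E)`, naturally in `E`, with inverse `g ⊗ [e] ↦ g S(e₍₋₁₎) ⊗_M e₍₀₎`. Since `G`
is faithfully flat over `M` by assumption and over the field `k` because it is nonzero, `Φ`
preserves and reflects exactness (`exact_iff_exact_phi`), and hence injectivity and surjectivity of
morphisms.

The quasi-inverse is the cotensor product `G □_H V`, the kernel of `g ⊗ v ↦ g₍₁₎ ⊗ π(g₍₂₎) ⊗ v - g ⊗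
λ(v)`. It needs a left `H`-comodule, and `λ(v) = S⁻¹(v₍₁₎) ⊗ v₍₀₎` provides one; this is the role of
the bijective antipode. Because `π` is onto with kernel `M⁺G`, there is an isomorphism `Φ(G ⊗ V) ≅ H
⊗ V`. Applying the exact functor `Φ` to `0 → G □_H V → G ⊗ V → G ⊗ H ⊗ V` therefore gives `0 → Φ(G
□_H V) → H ⊗ V → H ⊗ H ⊗ V` with second map `Δ ⊗ V - H ⊗ λ`. The kernel of that map is `λ(V) ≅ V`,
so the counit `Φ(G □_H V) → V` is bijective (`cotensorCounit_bijective`).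

For `E M⁺ ⊆ M⁺ E`, the map `e ↦ e₍₋₁₎ ⊗ [e₍₀₎]` is right `M`-linear and lands in `G □_H Φ(E)`. Its
image under `Φ` is a right inverse of the bijective counit, hence bijective, and since `Φ` reflects
bijectivity the map itself is bijective (`cotensorUnit_bijective`). Full faithfulness and essential
surjectivity follow.

For the tensor product, `[e m] = ε(m) [e]` and `[m f] = ε(m) [f]` make `[e ⊗_M f] ↦ [e] ⊗ [f]` well
defined. Its inverse is well defined because `e ⊗_M m f = e m ⊗_M f` lies in `M⁺ (E ⊗_M F)` when
`ε(m) = 0`. The antipode reverses products, which accounts for the order `w₍₁₎ v₍₁₎` in the coaction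
on `V ⊗ W`. -/

namespace QHS

noncomputable section

variable {k : Type} [Field k] {G H : Type u} [Ring G] [HopfAlgebra k G] [Ring H] [HopfAlgebra k H]
variable {π : G →ₐc[k] H}

/-! ### Multiplication by `G` and antipode identities. -/

section LeftMul

variable {X Y : Type*} [AddCommGroup X] [Module k X] [AddCommGroup Y] [Module k Y]

variable (k G X) in
/-- The left multiplication `g (h ⊗ x) = g h ⊗ x` of `G` on `G ⊗ X`. -/
def leftMul : G →ₗ[k] G ⊗[k] X →ₗ[k] G ⊗[k] X :=
  LinearMap.rTensorHom X ∘ₗ LinearMap.mul k G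

@[simp] theorem leftMul_tmul (g h : G) (x : X) :
    leftMul k G X g (h ⊗ₜ x) = (g * h) ⊗ₜ x := rfl

@[simp] theorem leftMul_one (z : G ⊗[k] X) : leftMul k G X 1 z = z := by
  induction z with
  | zero => simp
  | add x y hx hy => simp only [map_add, hx, hy]
  | tmul h x => simp

/-- `S(a₍₁₎) a₍₂₎ ⊗ x = ε(a) 1 ⊗ x`. -/
theorem lift_antipode_leftMul (z : G ⊗[k] X) :
    TensorProduct.lift (leftMul k G X ∘ₗ HopfAlgebra.antipode k)
      (TensorProduct.assoc k G G X ((Coalgebra.comul (R := k)).rTensor X z)) =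
    (TensorProduct.mk k G X 1) (TensorProduct.lid k X ((Coalgebra.counit (R := k)).rTensor X z)) := by
  induction z with
  | zero => simp
  | add x y hx hy => simp only [map_add, hx, hy]
  | tmul a x =>
    have h : ∀ w : G ⊗[k] G, TensorProduct.lift (leftMul k G X ∘ₗ HopfAlgebra.antipode k)
        (TensorProduct.assoc k G G X (w ⊗ₜ x)) =
        (LinearMap.mul' k G ((HopfAlgebra.antipode k).rTensor G w)) ⊗ₜ x := by
      intro w
      induction w with
      | zero => simp
      | add x y hx hy => simp only [map_add, add_tmul, hx, hy]
      | tmul a b => simp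
    rw [LinearMap.rTensor_tmul, h, HopfAlgebra.mul_antipode_rTensor_comul_apply]
    simp [Algebra.algebraMap_eq_smul_one, TensorProduct.smul_tmul]

end LeftMul

/-- `S(m₍₁₎) m₍₂₎ = ε(m)` for `m ∈ M`. -/
theorem antipode_mul_comulM (m : coinv π) :
    LinearMap.mul' k G (TensorProduct.map (HopfAlgebra.antipode k) (incl π) (comulM π m)) =
      algebraMap k G (epsM π m) := by
  have h : TensorProduct.map (HopfAlgebra.antipode k) (incl π) (comulM π m) =
      (HopfAlgebra.antipode k).rTensor G ((incl π).lTensor G (comulM π m)) :=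
    (LinearMap.congr_fun (LinearMap.rTensor_comp_lTensor G _ _) (comulM π m)).symm
  rw [h, incl_comulM, HopfAlgebra.mul_antipode_rTensor_comul_apply]
  rfl

namespace RelBimod

/-! ### Kernels in the category of relative bimodules. -/

section Kernel

variable {E F K : RelBimod π}

/-- Over a field, `G ⊗ -` is exact, so `G ⊗ ker f` is the kernel of `G ⊗ f`; colinearity of `f`
shows that `e₍₋₁₎ ⊗ f(e₍₀₎)` vanishes. -/
theorem coact_mem_ker (f : E ⟶ F) (e : LinearMap.ker f.toLin) :
    E.coact (e : E.carrier) ∈ LinearMap.range ((LinearMap.ker f.toLin).subtype.lTensor G) := by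
  have hex : Function.Exact (LinearMap.ker f.toLin).subtype f.toLin :=
    LinearMap.exact_subtype_ker_map _
  refine (Module.Flat.lTensor_exact (M := G) hex _).1 ?_
  rw [← f.map_coact, e.2, map_zero]

theorem kerIncl_injective (f : E ⟶ F) (X : Type*) [AddCommGroup X] [Module k X] :
    Function.Injective ((LinearMap.ker f.toLin).subtype.lTensor X) :=
  Module.Flat.lTensor_preserves_injective_linearMap _ Subtype.val_injective

/-- The coaction on the kernel of a morphism. -/
def kerCoact (f : E ⟶ F) : LinearMap.ker f.toLin →ₗ[k] G ⊗[k] LinearMap.ker f.toLin :=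
  (LinearEquiv.ofInjective _ (kerIncl_injective f G)).symm.toLinearMap ∘ₗ
    LinearMap.codRestrict _ (E.coact ∘ₗ (LinearMap.ker f.toLin).subtype) (coact_mem_ker f)

theorem incl_kerCoact (f : E ⟶ F) (e : LinearMap.ker f.toLin) :
    (LinearMap.ker f.toLin).subtype.lTensor G (kerCoact f e) = E.coact e :=
  congrArg Subtype.val <|
    LinearEquiv.apply_symm_apply (LinearEquiv.ofInjective _ (kerIncl_injective f G))
      (LinearMap.codRestrict _ (E.coact ∘ₗ (LinearMap.ker f.toLin).subtype) (coact_mem_ker f) e)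

/-- A family of endomorphisms commuting with `f`, restricted to the kernel of `f`. -/
def kerAct (f : E ⟶ F) (a : coinv π →ₗ[k] E.carrier →ₗ[k] E.carrier)
    (b : coinv π →ₗ[k] F.carrier →ₗ[k] F.carrier) (h : ∀ m e, f.toLin (a m e) = b m (f.toLin e)) :
    coinv π →ₗ[k] LinearMap.ker f.toLin →ₗ[k] LinearMap.ker f.toLin :=
  LinearMap.mk₂ k (fun m e => ⟨a m e, by
      rw [LinearMap.mem_ker, h, LinearMap.mem_ker.1 e.2, map_zero]⟩)
    (fun m n e => Subtype.ext (by simp)) (fun c m e => Subtype.ext (by simp))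
    (fun m e e' => Subtype.ext (by simp)) (fun c m e => Subtype.ext (by simp))

/-- The kernel of a morphism. -/
def kerObj (f : E ⟶ F) : RelBimod π where
  carrier := LinearMap.ker f.toLin
  lact := kerAct f E.lact F.lact f.map_lact
  ract := kerAct f E.ract F.ract f.map_ract
  coact := kerCoact f
  lact_one e := Subtype.ext (E.lact_one e)
  lact_mul m n e := Subtype.ext (E.lact_mul m n e)
  ract_one e := Subtype.ext (E.ract_one e)
  ract_mul m n e := Subtype.ext (E.ract_mul m n e)
  lact_ract m n e := Subtype.ext (E.lact_ract m n e)
  coassoc e := by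
    -- The coaction of the kernel is known only through its image in `G ⊗ E`, so each axiom is
    -- compared after an injective inclusion, where it becomes the axiom for `E`.
    have hinj : Function.Injective (((LinearMap.ker f.toLin).subtype.lTensor G).lTensor G) :=
      Module.Flat.lTensor_preserves_injective_linearMap _ (kerIncl_injective f G)
    apply hinj
    have h1 : ∀ x : G ⊗[k] LinearMap.ker f.toLin,
        ((LinearMap.ker f.toLin).subtype.lTensor G).lTensor G
          (TensorProduct.assoc k G G _ ((Coalgebra.comul (R := k)).rTensor _ x)) =
        TensorProduct.assoc k G G _ ((Coalgebra.comul (R := k)).rTensor _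
          ((LinearMap.ker f.toLin).subtype.lTensor G x)) := by
      intro x
      induction x with
      | zero => simp
      | add x y hx hy => simp only [map_add, hx, hy]
      | tmul a b =>
        simp only [LinearMap.rTensor_tmul, LinearMap.lTensor_tmul]
        generalize Coalgebra.comul (R := k) a = z
        induction z with
        | zero => simp
        | add x y hx hy => simp only [map_add, hx, hy, add_tmul]
        | tmul c d => simp
    have h2 : ∀ x : G ⊗[k] LinearMap.ker f.toLin,
        ((LinearMap.ker f.toLin).subtype.lTensor G).lTensor G ((kerCoact f).lTensor G x) =
        E.coact.lTensor G ((LinearMap.ker f.toLin).subtype.lTensor G x) := by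
      intro x
      induction x with
      | zero => simp
      | add x y hx hy => simp only [map_add, hx, hy]
      | tmul a b =>
        simp only [LinearMap.lTensor_tmul, incl_kerCoact]
        rfl
    rw [h1, h2, incl_kerCoact, E.coassoc]
  counit e := by
    apply kerIncl_injective f k
    have h1 : ∀ x : G ⊗[k] LinearMap.ker f.toLin, (LinearMap.ker f.toLin).subtype.lTensor k
        ((Coalgebra.counit (R := k)).rTensor _ x) =
        (Coalgebra.counit (R := k)).rTensor _ ((LinearMap.ker f.toLin).subtype.lTensor G x) := by
      intro x
      induction x with
      | zero => simp
      | add x y hx hy => simp only [map_add, hx, hy]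
      | tmul a b => simp
    rw [h1, incl_kerCoact, E.counit]
    rfl
  compat m n e := by
    apply kerIncl_injective f G
    have h1 : ∀ (s t : G ⊗[k] coinv π) (x : G ⊗[k] LinearMap.ker f.toLin),
        (LinearMap.ker f.toLin).subtype.lTensor G
          (TensorProduct.map₂ (LinearMap.mul k G).flip (kerAct f E.ract F.ract f.map_ract) t
            (TensorProduct.map₂ (LinearMap.mul k G) (kerAct f E.lact F.lact f.map_lact) s x)) =
        TensorProduct.map₂ (LinearMap.mul k G).flip E.ract t
          (TensorProduct.map₂ (LinearMap.mul k G) E.lact s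
            ((LinearMap.ker f.toLin).subtype.lTensor G x)) := by
      intro s t x
      induction s with
      | zero => simp
      | add x y hx hy => simp only [map_add, LinearMap.add_apply, hx, hy]
      | tmul a m =>
      induction t with
      | zero => simp
      | add x y hx hy => simp only [map_add, LinearMap.add_apply, hx, hy]
      | tmul b n =>
      induction x with
      | zero => simp
      | add x y hx hy => simp only [map_add, hx, hy]
      | tmul g e => rfl
    rw [h1, incl_kerCoact, incl_kerCoact]
    exact E.compat m n e

/-- The inclusion of the kernel of a morphism. -/
def kerι (f : E ⟶ F) : kerObj f ⟶ E where
  toLin := (LinearMap.ker f.toLin).subtype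
  map_lact _ _ := rfl
  map_ract _ _ := rfl
  map_coact e := (incl_kerCoact f e).symm

theorem kerι_injective (f : E ⟶ F) : Function.Injective (kerι f).toLin := Subtype.val_injective

theorem exact_kerι (f : E ⟶ F) : Function.Exact (kerι f).toLin f.toLin :=
  LinearMap.exact_subtype_ker_map _

/-- The universal property of the kernel. -/
def kerLift (f : E ⟶ F) (g : K ⟶ E) (h : ∀ x, f.toLin (g.toLin x) = 0) : K ⟶ kerObj f where
  toLin := g.toLin.codRestrict _ h
  map_lact m x := Subtype.ext (g.map_lact m x)
  map_ract m x := Subtype.ext (g.map_ract m x)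
  map_coact x := by
    apply kerIncl_injective f G
    refine (incl_kerCoact f _).trans ?_
    refine (g.map_coact x).trans ?_
    exact LinearMap.lTensor_comp_apply G (LinearMap.ker f.toLin).subtype
      (g.toLin.codRestrict _ h) (K.coact x)

/-- The zero morphism. -/
def zeroHom (E F : RelBimod π) : E ⟶ F where
  toLin := 0
  map_lact _ _ := by simp
  map_ract _ _ := by simp
  map_coact _ := by simp

/-- A bijective morphism is an isomorphism. -/
def isoOfBijective (f : E ⟶ F) (hf : Function.Bijective f.toLin) : E ≅ F :=
  mkIso f (LinearEquiv.ofBijective f.toLin hf).symm.toLinearMap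
    (fun e => LinearEquiv.symm_apply_apply (LinearEquiv.ofBijective f.toLin hf) e)
    (fun x => LinearEquiv.apply_symm_apply (LinearEquiv.ofBijective f.toLin hf) x)

end Kernel

/-! ### The objects `G ⊗ W`. -/

section Free

variable (π) in
/-- The object `G ⊗ W` with `m (g ⊗ w) n = m g n ⊗ w` and coaction `Δ ⊗ W`. -/
def free (W : Type u) [AddCommGroup W] [Module k W] : RelBimod π where
  carrier := G ⊗[k] W
  lact := leftMul k G W ∘ₗ incl π
  ract := LinearMap.rTensorHom W ∘ₗ (LinearMap.mul k G).flip ∘ₗ incl π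
  coact := (TensorProduct.assoc k G G W).toLinearMap ∘ₗ (Coalgebra.comul (R := k)).rTensor W
  lact_one e := leftMul_one e
  lact_mul m n e := by
    induction e with
    | zero => simp
    | add x y hx hy => simp only [map_add, hx, hy]
    | tmul g w => simp [mul_assoc]
  ract_one e := by
    induction e with
    | zero => simp
    | add x y hx hy => simp only [map_add, hx, hy]
    | tmul g w => simp
  ract_mul m n e := by
    induction e with
    | zero => simp
    | add x y hx hy => simp only [map_add, hx, hy]
    | tmul g w => simp [mul_assoc]
  lact_ract m n e := by
    induction e with
    | zero => simp
    | add x y hx hy => simp only [map_add, hx, hy]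
    | tmul g w => simp [mul_assoc]
  coassoc e := by
    induction e with
    | zero => simp
    | add x y hx hy => simp only [map_add, hx, hy]
    | tmul g w =>
      have h1 : ∀ z : G ⊗[k] G, TensorProduct.assoc k G G (G ⊗[k] W)
          ((Coalgebra.comul (R := k)).rTensor _ (TensorProduct.assoc k G G W (z ⊗ₜ w))) =
          (TensorProduct.assoc k G G W).toLinearMap.lTensor G (TensorProduct.assoc k G (G ⊗[k] G) W
            (TensorProduct.assoc k G G G ((Coalgebra.comul (R := k)).rTensor G z) ⊗ₜ w)) := by
        intro z
        induction z with
        | zero => simp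
        | add x y hx hy => simp only [map_add, add_tmul, hx, hy]
        | tmul a b =>
          simp only [assoc_tmul, LinearMap.rTensor_tmul]
          generalize Coalgebra.comul (R := k) a = y
          induction y with
          | zero => simp
          | add x y hx hy => simp only [map_add, add_tmul, hx, hy]
          | tmul c d => simp
      have h2 : ∀ z : G ⊗[k] G, ((TensorProduct.assoc k G G W).toLinearMap ∘ₗ
            (Coalgebra.comul (R := k)).rTensor W).lTensor G
            (TensorProduct.assoc k G G W (z ⊗ₜ w)) =
          (TensorProduct.assoc k G G W).toLinearMap.lTensor G (TensorProduct.assoc k G (G ⊗[k] G) W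
            ((Coalgebra.comul (R := k)).lTensor G z ⊗ₜ w)) := by
        intro z
        induction z with
        | zero => simp
        | add x y hx hy => simp only [map_add, add_tmul, hx, hy]
        | tmul a b => simp
      simp only [LinearMap.comp_apply, LinearEquiv.coe_coe, LinearMap.rTensor_tmul, h1]
      rw [h2, Coalgebra.coassoc_apply]
  counit e := by
    induction e with
    | zero => simp
    | add x y hx hy => simp only [map_add, tmul_add, hx, hy]
    | tmul g w =>
      have h1 : ∀ z : G ⊗[k] G, (Coalgebra.counit (R := k)).rTensor _
          (TensorProduct.assoc k G G W (z ⊗ₜ w)) =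
          TensorProduct.assoc k k G W ((Coalgebra.counit (R := k)).rTensor G z ⊗ₜ w) := by
        intro z
        induction z with
        | zero => simp
        | add x y hx hy => simp only [map_add, add_tmul, hx, hy]
        | tmul a b => simp
      simp only [LinearMap.comp_apply, LinearEquiv.coe_coe, LinearMap.rTensor_tmul, h1]
      rw [Coalgebra.rTensor_counit_comul]
      simp
  compat m n e := by
    induction e with
    | zero => simp
    | add x y hx hy => simp only [map_add, hx, hy]
    | tmul g w =>
      -- Compatibility amounts to `Δ(m g n) = Δ(m) Δ(g) Δ(n)`. The identity is stated for arbitrary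
      -- tensors `s`, `t`, `z` so that it can be reduced to pure ones.
      have h1 : ∀ (s t : G ⊗[k] coinv π) (z : G ⊗[k] G), TensorProduct.assoc k G G W
          (((incl π).lTensor G s * z * (incl π).lTensor G t) ⊗ₜ w) =
          TensorProduct.map₂ (LinearMap.mul k G).flip
            (LinearMap.rTensorHom W ∘ₗ (LinearMap.mul k G).flip ∘ₗ incl π) t
            (TensorProduct.map₂ (LinearMap.mul k G) (leftMul k G W ∘ₗ incl π) s
              (TensorProduct.assoc k G G W (z ⊗ₜ w))) := by
        intro s t z
        induction s with
        | zero => simp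
        | add x y hx hy => simp only [map_add, LinearMap.add_apply, add_mul, add_tmul, hx, hy]
        | tmul a m =>
        induction t with
        | zero => simp
        | add x y hx hy => simp only [map_add, LinearMap.add_apply, mul_add, add_tmul, hx, hy]
        | tmul b n =>
        induction z with
        | zero => simp
        | add x y hx hy => simp only [map_add, add_mul, mul_add, add_tmul, hx, hy]
        | tmul c d => simp
      refine Eq.trans ?_ (h1 (comulM π m) (comulM π n) (Coalgebra.comul (R := k) g))
      rw [incl_comulM, incl_comulM, ← Bialgebra.comul_mul, ← Bialgebra.comul_mul]
      rfl

end Free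

/-! ### The isomorphism of `G ⊗_M E` with `G ⊗ Φ(E)`. -/

section BaseChange

variable (E : RelBimod π)

/-- The vector space `G ⊗_M E`. -/
abbrev Base : Type u := BalancedTensor (rightMulG π) E.lact

theorem mk_mul_coinv (g : G) (m : coinv π) (e : E.carrier) :
    BalancedTensor.mk (rightMulG π) E.lact (g * m) e =
      BalancedTensor.mk (rightMulG π) E.lact g (E.lact m e) :=
  BalancedTensor.mk_balanced (r := rightMulG π) (l := E.lact) m g e

/-- The left multiplication of `G` on `G ⊗_M E`. -/
def baseMul : G →ₗ[k] E.Base →ₗ[k] E.Base where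
  toFun g := BalancedTensor.lift (BalancedTensor.mk (rightMulG π) E.lact ∘ₗ LinearMap.mulLeft k g)
    (fun m h e => by
      exact (congrArg (fun a => BalancedTensor.mk (rightMulG π) E.lact a e)
        (mul_assoc g h m).symm).trans (E.mk_mul_coinv (g * h) m e))
  map_add' g h := BalancedTensor.hom_ext fun a e => by
    change BalancedTensor.mk (rightMulG π) E.lact ((g + h) * a) e =
      BalancedTensor.mk (rightMulG π) E.lact (g * a) e +
        BalancedTensor.mk (rightMulG π) E.lact (h * a) e
    simp [add_mul]
  map_smul' c h := BalancedTensor.hom_ext fun a e => by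
    change BalancedTensor.mk (rightMulG π) E.lact ((c • h) * a) e =
      c • BalancedTensor.mk (rightMulG π) E.lact (h * a) e
    simp

@[simp] theorem baseMul_mk (g h : G) (e : E.carrier) :
    E.baseMul g (BalancedTensor.mk (rightMulG π) E.lact h e) =
      BalancedTensor.mk (rightMulG π) E.lact (g * h) e := rfl

theorem baseMul_mul (g h : G) (z : E.Base) : E.baseMul (g * h) z = E.baseMul g (E.baseMul h z) := by
  have : E.baseMul (g * h) = E.baseMul g ∘ₗ E.baseMul h :=
    BalancedTensor.hom_ext fun a e => by simp [mul_assoc]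
  exact LinearMap.congr_fun this z

/-- `e ↦ e₍₋₁₎ ⊗ [e₍₀₎]`. -/
def coactQ : E.carrier →ₗ[k] G ⊗[k] (E.carrier ⧸ E.augL) := E.augL.mkQ.lTensor G ∘ₗ E.coact

/-- In `m₍₁₎ e₍₋₁₎ ⊗ [m₍₂₎ e₍₀₎]` the class equals `ε(m₍₂₎) [e₍₀₎]`, and the counit axiom collapses
`m₍₁₎ ε(m₍₂₎)` to `m`. This left `M`-linearity lets `baseToPhi` descend to the balanced tensor
product. -/
theorem coactQ_lact (m : coinv π) (e : E.carrier) :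
    E.coactQ (E.lact m e) = leftMul k G _ (m : G) (E.coactQ e) := by
  have h : ∀ (t : G ⊗[k] coinv π) (x : G ⊗[k] E.carrier),
      E.augL.mkQ.lTensor G (TensorProduct.map₂ (LinearMap.mul k G) E.lact t x) =
      leftMul k G _ (TensorProduct.rid k G ((epsM π).lTensor G t)) (E.augL.mkQ.lTensor G x) := by
    intro t x
    induction t with
    | zero => simp
    | add x y hx hy => simp only [map_add, LinearMap.add_apply, hx, hy]
    | tmul a m =>
    induction x with
    | zero => simp
    | add x y hx hy => simp only [map_add, hx, hy]
    | tmul g e =>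
      simp only [map₂_apply_tmul, map_tmul, LinearMap.lTensor_tmul, mkQ_lact, TensorProduct.rid_tmul,
        map_smul, LinearMap.smul_apply, leftMul_tmul, LinearMap.mul_apply', TensorProduct.tmul_smul]
  refine (congrArg _ (E.coact_lact m e)).trans ((h _ _).trans ?_)
  rw [comulM_epsM, TensorProduct.rid_tmul, one_smul]
  rfl

/-- `g ⊗_M e ↦ g e₍₋₁₎ ⊗ [e₍₀₎]`. -/
def baseToPhi : E.Base →ₗ[k] G ⊗[k] (E.carrier ⧸ E.augL) :=
  BalancedTensor.lift ((leftMul k G (E.carrier ⧸ E.augL)).compl₂ E.coactQ) (fun m g e => by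
    simp only [LinearMap.compl₂_apply, coactQ_lact]
    generalize E.coactQ e = x
    induction x with
    | zero => simp
    | add x y hx hy => simp only [map_add, hx, hy]
    | tmul h v => simp [rightMulG, mul_assoc])

@[simp] theorem baseToPhi_mk (g : G) (e : E.carrier) :
    E.baseToPhi (BalancedTensor.mk (rightMulG π) E.lact g e) = leftMul k G _ g (E.coactQ e) := rfl

theorem baseToPhi_baseMul (g : G) (z : E.Base) :
    E.baseToPhi (E.baseMul g z) = leftMul k G _ g (E.baseToPhi z) := by
  have : E.baseToPhi ∘ₗ E.baseMul g = leftMul k G _ g ∘ₗ E.baseToPhi :=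
    BalancedTensor.hom_ext fun a e => by
      simp only [LinearMap.comp_apply, baseMul_mk, baseToPhi_mk]
      generalize E.coactQ e = x
      induction x with
      | zero => simp
      | add x y hx hy => simp only [map_add, hx, hy]
      | tmul h v => simp [mul_assoc]
  exact LinearMap.congr_fun this z

/-- `g ⊗ e ↦ S(g) ⊗_M e`. -/
def antiMk : G ⊗[k] E.carrier →ₗ[k] E.Base :=
  TensorProduct.lift (BalancedTensor.mk (rightMulG π) E.lact ∘ₗ HopfAlgebra.antipode k)

@[simp] theorem antiMk_tmul (g : G) (e : E.carrier) :
    E.antiMk (g ⊗ₜ e) =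
      BalancedTensor.mk (rightMulG π) E.lact (HopfAlgebra.antipode k g) e := rfl

/-- Here `S(m₍₁₎ e₍₋₁₎) ⊗_M m₍₂₎ e₍₀₎ = S(e₍₋₁₎) S(m₍₁₎) m₍₂₎ ⊗_M e₍₀₎`, because `m₍₂₎ ∈ M` can
cross the tensor sign. The antipode axiom leaves `ε(m)`, so the map kills `M⁺E`. -/
theorem antiMk_coact_lact (m : coinv π) (e : E.carrier) :
    E.antiMk (E.coact (E.lact m e)) = epsM π m • E.antiMk (E.coact e) := by
  rw [E.coact_lact]
  generalize E.coact e = x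
  induction x with
  | zero => simp
  | add x y hx hy => simp only [map_add, smul_add, hx, hy]
  | tmul g e =>
    have h : ∀ t : G ⊗[k] coinv π, E.antiMk
        (TensorProduct.map₂ (LinearMap.mul k G) E.lact t (g ⊗ₜ e)) =
        BalancedTensor.mk (rightMulG π) E.lact (HopfAlgebra.antipode k g *
          LinearMap.mul' k G (TensorProduct.map (HopfAlgebra.antipode k) (incl π) t)) e := by
      intro t
      induction t with
      | zero => simp
      | add x y hx hy => simp only [map_add, LinearMap.add_apply, mul_add, hx, hy]
      | tmul a n =>
        simp only [map₂_apply_tmul, map_tmul, antiMk_tmul, ← mk_mul_coinv]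
        simp [HopfAlgebra.antipode_mul_antidistrib, mul_assoc]
    rw [h, antipode_mul_comulM, Algebra.algebraMap_eq_smul_one]
    simp

/-- `[e] ↦ S(e₍₋₁₎) ⊗_M e₍₀₎`. -/
def phiToBase₁ : (E.carrier ⧸ E.augL) →ₗ[k] E.Base :=
  E.augL.liftQ (E.antiMk ∘ₗ E.coact) (by
    refine Submodule.span_le.2 ?_
    rintro _ ⟨m, e, hm, rfl⟩
    change E.antiMk (E.coact _) = 0
    rw [antiMk_coact_lact, hm, zero_smul])

@[simp] theorem phiToBase₁_mkQ (e : E.carrier) :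
    E.phiToBase₁ (E.augL.mkQ e) = E.antiMk (E.coact e) := rfl

/-- `g ⊗ [e] ↦ g S(e₍₋₁₎) ⊗_M e₍₀₎`. -/
def phiToBase : G ⊗[k] (E.carrier ⧸ E.augL) →ₗ[k] E.Base :=
  TensorProduct.lift (E.baseMul.compl₂ E.phiToBase₁)

theorem phiToBase_leftMul (g : G) (z : G ⊗[k] (E.carrier ⧸ E.augL)) :
    E.phiToBase (leftMul k G _ g z) = E.baseMul g (E.phiToBase z) := by
  induction z with
  | zero => simp
  | add x y hx hy => simp only [map_add, hx, hy]
  | tmul h v => simp [phiToBase, baseMul_mul]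

/-- By coassociativity the left side is `S(e₍₋₂₎) e₍₋₁₎ ⊗ [e₍₀₎]`, and the antipode axiom applies.
This is one half of the invertibility of `baseToPhi`. -/
theorem baseToPhi_antiMk_coact (e : E.carrier) :
    E.baseToPhi (E.antiMk (E.coact e)) = 1 ⊗ₜ E.augL.mkQ e := by
  have h1 : ∀ x : G ⊗[k] E.carrier, E.baseToPhi (E.antiMk x) =
      E.augL.mkQ.lTensor G (TensorProduct.lift (leftMul k G _ ∘ₗ HopfAlgebra.antipode k)
        (E.coact.lTensor G x)) := by
    intro x
    induction x with
    | zero => simp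
    | add x y hx hy => simp only [map_add, hx, hy]
    | tmul g e =>
      simp only [antiMk_tmul, baseToPhi_mk, LinearMap.lTensor_tmul, lift.tmul, coactQ,
        LinearMap.comp_apply]
      generalize E.coact e = y
      induction y with
      | zero => simp
      | add x y hx hy => simp only [map_add, hx, hy]
      | tmul h e => simp
  rw [h1, ← E.coassoc, lift_antipode_leftMul, E.counit]
  simp

/-- The other half: by coassociativity the left side is `e₍₋₂₎ S(e₍₋₁₎) ⊗_M e₍₀₎`, which uses the
antipode axiom on the opposite side. -/
theorem phiToBase_coactQ (e : E.carrier) :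
    E.phiToBase (E.coactQ e) = BalancedTensor.mk (rightMulG π) E.lact 1 e := by
  let P : G ⊗[k] (G ⊗[k] E.carrier) →ₗ[k] E.Base :=
    TensorProduct.lift (E.baseMul.compl₂ E.antiMk)
  have h1 : ∀ x : G ⊗[k] E.carrier, E.phiToBase (E.augL.mkQ.lTensor G x) =
      P (E.coact.lTensor G x) := by
    intro x
    induction x with
    | zero => simp
    | add x y hx hy => simp only [map_add, hx, hy]
    | tmul g e => rfl
  have h2 : ∀ x : G ⊗[k] E.carrier,
      P (TensorProduct.assoc k G G _ ((Coalgebra.comul (R := k)).rTensor _ x)) =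
      BalancedTensor.mk (rightMulG π) E.lact 1
        (TensorProduct.lid k _ ((Coalgebra.counit (R := k)).rTensor _ x)) := by
    intro x
    induction x with
    | zero => simp
    | add x y hx hy => simp only [map_add, hx, hy]
    | tmul g e =>
      have h3 : ∀ z : G ⊗[k] G, P (TensorProduct.assoc k G G _ (z ⊗ₜ e)) =
          BalancedTensor.mk (rightMulG π) E.lact
            (LinearMap.mul' k G ((HopfAlgebra.antipode k).lTensor G z)) e := by
        intro z
        induction z with
        | zero => simp
        | add x y hx hy => simp only [map_add, add_tmul, LinearMap.add_apply, hx, hy]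
        | tmul a b => simp [P]
      rw [LinearMap.rTensor_tmul, h3, HopfAlgebra.mul_antipode_lTensor_comul_apply]
      simp [Algebra.algebraMap_eq_smul_one]
  refine (h1 _).trans ?_
  rw [← E.coassoc, h2, E.counit]
  simp

/-- The isomorphism `G ⊗_M E ≅ G ⊗ Φ(E)`. -/
def baseEquiv : E.Base ≃ₗ[k] G ⊗[k] (E.carrier ⧸ E.augL) :=
  LinearEquiv.ofLinearMap E.baseToPhi E.phiToBase
    -- Both maps commute with left multiplication by `G`, so each composite is determined by its
    -- values at `g = 1`.
    (TensorProduct.ext' fun g v => by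
      obtain ⟨e, rfl⟩ := E.augL.mkQ_surjective v
      simp only [LinearMap.comp_apply, phiToBase, lift.tmul, LinearMap.compl₂_apply,
        baseToPhi_baseMul, phiToBase₁_mkQ, baseToPhi_antiMk_coact]
      simp)
    (BalancedTensor.hom_ext fun g e => by
      simp only [LinearMap.comp_apply, baseToPhi_mk, phiToBase_leftMul, phiToBase_coactQ]
      simp)

end BaseChange

/-! ### Exactness properties of `Φ`. -/

/-- The left `M`-module underlying an object. -/
abbrev leftModule (E : RelBimod π) : Module (coinv π) E.carrier where
  smul m e := E.lact m e
  one_smul := E.lact_one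
  mul_smul := E.lact_mul
  smul_zero m := map_zero (E.lact m)
  smul_add m := map_add (E.lact m)
  add_smul m n e := by
    change E.lact (m + n) e = E.lact m e + E.lact n e
    simp
  zero_smul e := by
    change E.lact 0 e = 0
    simp

theorem leftModule_isScalarTower (E : RelBimod π) :
    letI := E.leftModule
    IsScalarTower k (coinv π) E.carrier :=
  letI := E.leftModule
  ⟨fun c m e => by
    change E.lact (c • m) e = c • E.lact m e
    simp⟩

variable {E F K : RelBimod π}

/-- The map `G ⊗_M f`. -/
def baseHom (f : E ⟶ F) : E.Base →ₗ[k] F.Base :=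
  BalancedTensor.lift ((BalancedTensor.mk (rightMulG π) F.lact).compl₂ f.toLin) (fun m g e => by
    simp only [LinearMap.compl₂_apply, f.map_lact, BalancedTensor.mk_balanced])

/-- Faithful flatness is phrased for typeclass `M`-modules. Declaring the left action as the scalar
action turns morphisms into `M`-linear maps and identifies `baseMap` with `baseHom` definitionally.
-/
theorem exact_baseHom_iff (hff : IsFaithfullyFlat π) (f : E ⟶ F) (g : F ⟶ K) :
    Function.Exact f.toLin g.toLin ↔ Function.Exact (baseHom f) (baseHom g) := by
  let _ := E.leftModule
  let _ := F.leftModule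
  let _ := K.leftModule
  have _ := E.leftModule_isScalarTower
  have _ := F.leftModule_isScalarTower
  have _ := K.leftModule_isScalarTower
  let f' : E.carrier →ₗ[coinv π] F.carrier := { f.toLin with map_smul' := f.map_lact }
  let g' : F.carrier →ₗ[coinv π] K.carrier := { g.toLin with map_smul' := g.map_lact }
  exact hff E.carrier F.carrier K.carrier f' g'

/-- Naturality of the isomorphism, which is colinearity of `f`; it carries exactness from `G ⊗_M f`
to `G ⊗ Φ(f)`. -/
theorem baseEquiv_baseHom (f : E ⟶ F) (z : E.Base) :
    F.baseEquiv (baseHom f z) = ((Phi π).map f).toLin.lTensor G (E.baseEquiv z) := by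
  have : F.baseToPhi ∘ₗ baseHom f = ((Phi π).map f).toLin.lTensor G ∘ₗ E.baseToPhi :=
    BalancedTensor.hom_ext fun g e => by
      let p : (E.carrier ⧸ E.augL) →ₗ[k] (F.carrier ⧸ F.augL) := ((Phi π).map f).toLin
      change leftMul k G _ g (F.augL.mkQ.lTensor G (F.coact (f.toLin e))) =
        p.lTensor G (leftMul k G _ g (E.augL.mkQ.lTensor G (E.coact e)))
      rw [f.map_coact]
      generalize E.coact e = x
      induction x with
      | zero => simp
      | add x y hx hy => simp only [map_add, hx, hy]
      | tmul h e => rfl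
  exact LinearMap.congr_fun this z

/-- `Φ` preserves and reflects exactness. -/
theorem exact_iff_exact_phi (hff : IsFaithfullyFlat π) (f : E ⟶ F) (g : F ⟶ K) :
    Function.Exact f.toLin g.toLin ↔
      Function.Exact ((Phi π).map f).toLin ((Phi π).map g).toLin := by
  rw [exact_baseHom_iff hff]
  -- The counit sends `1` to `1 ≠ 0`, so `G` is a nonzero vector space and hence faithfully flat
  -- over `k`.
  have : Nontrivial G := nontrivial_of_ne 1 0 fun h => one_ne_zero (α := k) <| by
    rw [← Bialgebra.counit_one (R := k) (A := G), h, map_zero]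
  have h := Module.FaithfullyFlat.lTensor_exact_iff_exact k G ((Phi π).map f).toLin
    ((Phi π).map g).toLin
  rw [← h]
  let e (E : RelBimod π) : E.Base ≃ₗ[k] G ⊗[k] ((Phi π).obj E).carrier := E.baseEquiv
  exact (Function.Exact.iff_of_ladder_linearEquiv (e₁ := e E) (e₂ := e F) (e₃ := e K)
    (LinearMap.ext fun z => (baseEquiv_baseHom f z).symm)
    (LinearMap.ext fun z => (baseEquiv_baseHom g z).symm)).symm

theorem phi_map_zeroHom : ((Phi π).map (zeroHom E F)).toLin = 0 :=
  Submodule.linearMap_qext _ (LinearMap.ext fun _ => map_zero F.augL.mkQ)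

/-- Injectivity is exactness after a zero map, and `Φ` sends zero maps to zero maps. -/
theorem phi_injective_iff (hff : IsFaithfullyFlat π) (f : E ⟶ F) :
    Function.Injective ((Phi π).map f).toLin ↔ Function.Injective f.toLin := by
  have h := exact_iff_exact_phi hff (zeroHom E E) f
  rw [phi_map_zeroHom] at h
  rw [← LinearMap.exact_zero_iff_injective ((Phi π).obj E).carrier,
    ← LinearMap.exact_zero_iff_injective E.carrier]
  exact h.symm

theorem phi_surjective_iff (hff : IsFaithfullyFlat π) (f : E ⟶ F) :
    Function.Surjective ((Phi π).map f).toLin ↔ Function.Surjective f.toLin := by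
  have h := exact_iff_exact_phi hff f (zeroHom F F)
  rw [phi_map_zeroHom] at h
  rw [← LinearMap.exact_zero_iff_surjective ((Phi π).obj F).carrier,
    ← LinearMap.exact_zero_iff_surjective F.carrier]
  exact h.symm

/-! ### The cotensor product and the bijection of `Φ(G □_H V)` with `V`. -/

section Cotensor

variable {E F : RelBimod π}
variable {V W : Type u} [AddCommGroup V] [Module k V] [AddCommGroup W] [Module k W]

/-- The difference of two morphisms. -/
def subHom (f g : E ⟶ F) : E ⟶ F where
  toLin := f.toLin - g.toLin
  map_lact m e := by simp [f.map_lact, g.map_lact]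
  map_ract m e := by simp [f.map_ract, g.map_ract]
  map_coact e := by simp [f.map_coact, g.map_coact, LinearMap.lTensor_sub]

variable (π) in
/-- The morphism `G ⊗ p`. -/
def freeMap (p : V →ₗ[k] W) : free π V ⟶ free π W where
  toLin := p.lTensor G
  map_lact m e := by
    change p.lTensor G (leftMul k G V (m : G) e) = leftMul k G W (m : G) (p.lTensor G e)
    induction e using TensorProduct.induction_on with
    | zero => simp
    | add x y hx hy => simp only [map_add, hx, hy]
    | tmul g v => simp
  map_ract m e := by
    change p.lTensor G ((LinearMap.mulRight k (m : G)).rTensor V e) =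
      (LinearMap.mulRight k (m : G)).rTensor W (p.lTensor G e)
    induction e using TensorProduct.induction_on with
    | zero => simp
    | add x y hx hy => simp only [map_add, hx, hy]
    | tmul g v => simp
  map_coact e := by
    change TensorProduct.assoc k G G W ((Coalgebra.comul (R := k)).rTensor W (p.lTensor G e)) =
      (p.lTensor G).lTensor G (TensorProduct.assoc k G G V ((Coalgebra.comul (R := k)).rTensor V e))
    induction e using TensorProduct.induction_on with
    | zero => simp
    | add x y hx hy => simp only [map_add, hx, hy]
    | tmul g v =>
      simp only [LinearMap.lTensor_tmul, LinearMap.rTensor_tmul]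
      generalize Coalgebra.comul (R := k) g = z
      induction z with
      | zero => simp
      | add x y hx hy => simp only [map_add, add_tmul, hx, hy]
      | tmul a b => simp

variable (π V) in
/-- The morphism `g ⊗ v ↦ g₍₁₎ ⊗ π(g₍₂₎) ⊗ v`. -/
def freeCoact : free π V ⟶ free π (H ⊗[k] V) where
  toLin := (TensorProduct.assoc k G H V).toLinearMap ∘ₗ (homCoact π).toLinearMap.rTensor V
  map_lact m e := by
    change TensorProduct.assoc k G H V ((homCoact π).toLinearMap.rTensor V
        (leftMul k G V (m : G) e)) = leftMul k G (H ⊗[k] V) (m : G)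
      (TensorProduct.assoc k G H V ((homCoact π).toLinearMap.rTensor V e))
    induction e using TensorProduct.induction_on with
    | zero => simp
    | add x y hx hy => simp only [map_add, hx, hy]
    | tmul g v =>
      -- `homCoact` is an algebra map with value `m ⊗ 1` at `m ∈ M`, so multiplication by `m`
      -- touches only the `G` factor. The same holds for the right action.
      simp only [leftMul_tmul, LinearMap.rTensor_tmul, AlgHom.toLinearMap_apply, map_mul,
        coinv_prop]
      generalize homCoact π g = z
      induction z with
      | zero => simp
      | add x y hx hy => simp only [map_add, mul_add, add_tmul, hx, hy]
      | tmul a b => simp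
  map_ract m e := by
    change TensorProduct.assoc k G H V ((homCoact π).toLinearMap.rTensor V
        ((LinearMap.mulRight k (m : G)).rTensor V e)) =
      (LinearMap.mulRight k (m : G)).rTensor (H ⊗[k] V)
        (TensorProduct.assoc k G H V ((homCoact π).toLinearMap.rTensor V e))
    induction e using TensorProduct.induction_on with
    | zero => simp
    | add x y hx hy => simp only [map_add, hx, hy]
    | tmul g v =>
      simp only [LinearMap.mulRight_apply, LinearMap.rTensor_tmul, AlgHom.toLinearMap_apply,
        map_mul, coinv_prop]
      generalize homCoact π g = z
      induction z with
      | zero => simp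
      | add x y hx hy => simp only [map_add, add_mul, add_tmul, hx, hy]
      | tmul a b => simp
  map_coact e := by
    change TensorProduct.assoc k G G (H ⊗[k] V) ((Coalgebra.comul (R := k)).rTensor _
        (TensorProduct.assoc k G H V ((homCoact π).toLinearMap.rTensor V e))) =
      ((TensorProduct.assoc k G H V).toLinearMap ∘ₗ
        (homCoact π).toLinearMap.rTensor V).lTensor G
        (TensorProduct.assoc k G G V ((Coalgebra.comul (R := k)).rTensor V e))
    induction e using TensorProduct.induction_on with
    | zero => simp
    | add x y hx hy => simp only [map_add, hx, hy]
    | tmul g v =>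
      have h1 : ∀ z : G ⊗[k] H, TensorProduct.assoc k G G (H ⊗[k] V)
          ((Coalgebra.comul (R := k)).rTensor _ (TensorProduct.assoc k G H V (z ⊗ₜ v))) =
          (TensorProduct.assoc k G H V).toLinearMap.lTensor G
            (TensorProduct.assoc k G (G ⊗[k] H) V
              (TensorProduct.assoc k G G H ((Coalgebra.comul (R := k)).rTensor H z) ⊗ₜ v)) := by
        intro z
        induction z with
        | zero => simp
        | add x y hx hy => simp only [map_add, add_tmul, hx, hy]
        | tmul a b =>
          simp only [assoc_tmul, LinearMap.rTensor_tmul]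
          generalize Coalgebra.comul (R := k) a = y
          induction y with
          | zero => simp
          | add x y hx hy => simp only [map_add, add_tmul, hx, hy]
          | tmul c d => simp
      have h2 : ∀ z : G ⊗[k] G, ((TensorProduct.assoc k G H V).toLinearMap ∘ₗ
            (homCoact π).toLinearMap.rTensor V).lTensor G
            (TensorProduct.assoc k G G V (z ⊗ₜ v)) =
          (TensorProduct.assoc k G H V).toLinearMap.lTensor G
            (TensorProduct.assoc k G (G ⊗[k] H) V
              ((homCoact π).toLinearMap.lTensor G z ⊗ₜ v)) := by
        intro z
        induction z with
        | zero => simp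
        | add x y hx hy => simp only [map_add, add_tmul, hx, hy]
        | tmul a b => simp
      rw [LinearMap.rTensor_tmul, LinearMap.rTensor_tmul, AlgHom.toLinearMap_apply, h1, h2,
        homCoact_coassoc]

variable (π) in
/-- The morphism `g ⊗ v ↦ g₍₁₎ ⊗ π(g₍₂₎) ⊗ v - g ⊗ λ(v)`, whose kernel is `G □_H V`. -/
def cotensorMap (lam : V →ₗ[k] H ⊗[k] V) : free π V ⟶ free π (H ⊗[k] V) :=
  subHom (freeCoact π V) (freeMap π lam)

variable (π) in
/-- The cotensor product `G □_H V`. -/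
def cotensor (lam : V →ₗ[k] H ⊗[k] V) : RelBimod π := kerObj (cotensorMap π lam)

theorem cotensorMap_apply (lam : V →ₗ[k] H ⊗[k] V) (x : G ⊗[k] V) :
    (cotensorMap π lam).toLin x =
      TensorProduct.assoc k G H V ((homCoact π).toLinearMap.rTensor V x) - lam.lTensor G x := rfl

variable (π V) in
/-- The map `Φ(G ⊗ V) → H ⊗ V`, `[g ⊗ v] ↦ π(g) ⊗ v`. -/
def phiFree : ((Phi π).obj (free π V)).carrier →ₗ[k] H ⊗[k] V :=
  (free π V).augL.liftQ ((π : G →ₗ[k] H).rTensor V) (by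
    refine Submodule.span_le.2 ?_
    rintro _ ⟨m, e, hm, rfl⟩
    change (π : G →ₗ[k] H).rTensor V (leftMul k G V (m : G) e) = 0
    induction e using TensorProduct.induction_on with
    | zero => simp
    | add x y hx hy => simp only [map_add, hx, hy, add_zero]
    | tmul g v =>
      have : π (m * g : G) = 0 := by
        rw [map_mul, pi_coinv, hm, map_zero, zero_mul]
      change π (m * g : G) ⊗ₜ[k] v = 0
      rw [this, zero_tmul])

theorem phiFree_surjective (hsurj : Function.Surjective π) :
    Function.Surjective (phiFree π V) := by
  intro y
  obtain ⟨x, rfl⟩ := LinearMap.rTensor_surjective V (g := (π : G →ₗ[k] H)) hsurj y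
  exact ⟨phiClass (free π V) x, rfl⟩

/-- Right exactness of `- ⊗ V` says that the kernel of `π ⊗ V` is the image of `ker π ⊗ V`. By `ker
π = M⁺G` this image lies in `M⁺(G ⊗ V)`, which is zero in the quotient. -/
theorem phiFree_injective (hsurj : Function.Surjective π)
    (hker : LinearMap.ker (π : G →ₗ[k] H) = augG π) : Function.Injective (phiFree π V) := by
  rw [injective_iff_map_eq_zero]
  intro y hy
  obtain ⟨x, rfl⟩ := (free π V).augL.mkQ_surjective y
  have hex : Function.Exact (LinearMap.ker (π : G →ₗ[k] H)).subtype (π : G →ₗ[k] H) :=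
    LinearMap.exact_subtype_ker_map _
  obtain ⟨z, rfl⟩ := (rTensor_exact V hex hsurj x).1 hy
  refine (Submodule.Quotient.mk_eq_zero _).2 ?_
  clear hy
  induction z with
  | zero =>
    rw [map_zero]
    exact zero_mem _
  | add x y hx hy =>
    rw [map_add]
    exact add_mem hx hy
  | tmul n v =>
    obtain ⟨n, hn⟩ := n
    rw [hker] at hn
    have h : augG π ≤ (free π V).augL.comap ((TensorProduct.mk k G V).flip v) := by
      refine Submodule.span_le.2 ?_
      rintro _ ⟨m, g, hm, rfl⟩
      exact Submodule.subset_span ⟨m, g ⊗ₜ v, hm, rfl⟩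
    exact h hn

variable (π) in
/-- The map `Φ(G □_H V) → V`, `[g ⊗ v] ↦ ε(g) v`. -/
def cotensorCounit (lam : V →ₗ[k] H ⊗[k] V) : ((Phi π).obj (cotensor π lam)).carrier →ₗ[k] V :=
  (cotensor π lam).augL.liftQ ((TensorProduct.lid k V).toLinearMap ∘ₗ
      (Coalgebra.counit (R := k) (A := G)).rTensor V ∘ₗ (kerι (cotensorMap π lam)).toLin) (by
    refine Submodule.span_le.2 ?_
    rintro _ ⟨m, ⟨e, he⟩, hm, rfl⟩
    change TensorProduct.lid k V ((Coalgebra.counit (R := k) (A := G)).rTensor V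
      (leftMul k G V (m : G) e)) = 0
    clear he
    induction e using TensorProduct.induction_on with
    | zero => simp
    | add x y hx hy => simp only [map_add, hx, hy, add_zero]
    | tmul g v =>
      have : Coalgebra.counit (R := k) (m : G) = 0 := hm
      simp [this])

variable {lam : V →ₗ[k] H ⊗[k] V}

/-- `π(g) ⊗ v = ε(g) λ(v)` on `G □_H V`. -/
theorem phiFree_phi_kerι (y : ((Phi π).obj (cotensor π lam)).carrier) :
    phiFree π V (((Phi π).map (kerι (cotensorMap π lam))).toLin y) =
      lam (cotensorCounit π lam y) := by
  obtain ⟨⟨x, hx⟩, rfl⟩ := (cotensor π lam).augL.mkQ_surjective y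
  change (π : G →ₗ[k] H).rTensor V x =
    lam (TensorProduct.lid k V ((Coalgebra.counit (R := k) (A := G)).rTensor V x))
  -- Apply `ε` to the first leg of the equation `g₍₁₎ ⊗ π(g₍₂₎) ⊗ v = g ⊗ λ(v)` that defines the
  -- cotensor product.
  have h := congrArg (fun z => TensorProduct.lid k _
    ((Coalgebra.counit (R := k) (A := G)).rTensor (H ⊗[k] V) z)) (sub_eq_zero.1 hx)
  have h1 : ∀ x : G ⊗[k] V, TensorProduct.lid k _ ((Coalgebra.counit (R := k) (A := G)).rTensor
      (H ⊗[k] V) (TensorProduct.assoc k G H V ((homCoact π).toLinearMap.rTensor V x))) =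
      (π : G →ₗ[k] H).rTensor V x := by
    intro x
    induction x with
    | zero => simp
    | add x y hx hy => simp only [map_add, hx, hy]
    | tmul g v =>
      have h2 : ∀ z : G ⊗[k] G, TensorProduct.lid k _ ((Coalgebra.counit (R := k) (A := G)).rTensor
          (H ⊗[k] V) (TensorProduct.assoc k G H V
            (TensorProduct.map LinearMap.id (π : G →ₗ[k] H) z ⊗ₜ v))) =
          (π : G →ₗ[k] H) (TensorProduct.lid k _ ((Coalgebra.counit (R := k) (A := G)).rTensor G z))
            ⊗ₜ v := by
        intro z
        induction z with
        | zero => simp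
        | add x y hx hy => simp only [map_add, add_tmul, hx, hy]
        | tmul a b => simp [TensorProduct.smul_tmul']
      refine (h2 (Coalgebra.comul (R := k) g)).trans ?_
      rw [Coalgebra.rTensor_counit_comul]
      simp
  have h3 : ∀ x : G ⊗[k] V, TensorProduct.lid k _ ((Coalgebra.counit (R := k) (A := G)).rTensor
      (H ⊗[k] V) (lam.lTensor G x)) =
      lam (TensorProduct.lid k V ((Coalgebra.counit (R := k) (A := G)).rTensor V x)) := by
    intro x
    induction x with
    | zero => simp
    | add x y hx hy => simp only [map_add, hx, hy]
    | tmul g v => simp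
  exact (h1 x).symm.trans (h.trans (h3 x))

/-- Since `π` is a coalgebra map, `Φ` turns the defining map of `G □_H V` into the corresponding map
`Δ ⊗ V - H ⊗ λ` for `H □_H V`. Coassociativity of `λ` says exactly that this map vanishes on `λ(V)`.
-/
theorem phiFree_phi_cotensorMap (z : ((Phi π).obj (free π V)).carrier) :
    phiFree π (H ⊗[k] V) (((Phi π).map (cotensorMap π lam)).toLin z) =
      TensorProduct.assoc k H H V ((Coalgebra.comul (R := k)).rTensor V (phiFree π V z)) -
        lam.lTensor H (phiFree π V z) := by
  obtain ⟨x, rfl⟩ := (free π V).augL.mkQ_surjective z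
  change (π : G →ₗ[k] H).rTensor _ (TensorProduct.assoc k G H V
      ((homCoact π).toLinearMap.rTensor V x) - lam.lTensor G x) =
    TensorProduct.assoc k H H V ((Coalgebra.comul (R := k)).rTensor V
      ((π : G →ₗ[k] H).rTensor V x)) - lam.lTensor H ((π : G →ₗ[k] H).rTensor V x)
  induction x using TensorProduct.induction_on with
  | zero => simp
  | add x y hx hy =>
    simp only [map_add, map_sub] at hx hy ⊢
    rw [add_sub_add_comm, hx, hy]
    abel
  | tmul g v =>
    have h1 : ∀ z : G ⊗[k] G, (π : G →ₗ[k] H).rTensor _ (TensorProduct.assoc k G H V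
          (TensorProduct.map LinearMap.id (π : G →ₗ[k] H) z ⊗ₜ v)) =
        TensorProduct.assoc k H H V
          (TensorProduct.map (π : G →ₗ[k] H) (π : G →ₗ[k] H) z ⊗ₜ v) := by
      intro z
      induction z with
      | zero => simp
      | add x y hx hy => simp only [map_add, add_tmul, hx, hy]
      | tmul a b => simp
    have h2 : TensorProduct.map (π : G →ₗ[k] H) (π : G →ₗ[k] H) (Coalgebra.comul (R := k) g) =
        Coalgebra.comul (R := k) ((π : G →ₗ[k] H) g) := CoalgHomClass.map_comp_comul_apply π g
    have h3 := h1 (Coalgebra.comul (R := k) g)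
    rw [h2] at h3
    rw [map_sub]
    refine congrArg₂ (· - ·) h3 ?_
    simp

/-- Through `phiFree`, the image of the kernel inclusion under `Φ` becomes `λ` composed with the
counit. Injectivity follows since `Φ` preserves injections and `phiFree` is injective. For
surjectivity, `λ(v)` lifts to `Φ(G ⊗ V)`, and coassociativity with exactness of `Φ` lifts it further
to `Φ(G □_H V)`. -/
theorem cotensorCounit_bijective (hff : IsFaithfullyFlat π) (hsurj : Function.Surjective π)
    (hker : LinearMap.ker (π : G →ₗ[k] H) = augG π)
    (hco : ∀ v, TensorProduct.assoc k H H V ((Coalgebra.comul (R := k)).rTensor V (lam v)) =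
      lam.lTensor H (lam v))
    (hcu : ∀ v, (Coalgebra.counit (R := k)).rTensor V (lam v) = 1 ⊗ₜ[k] v) :
    Function.Bijective (cotensorCounit π lam) := by
  -- The counit axiom provides a retraction of `λ`.
  have hlam : Function.Injective lam := fun v w h => by
    have := (hcu v).symm.trans ((congrArg _ h).trans (hcu w))
    simpa using congrArg (TensorProduct.lid k V) this
  constructor
  · have h1 := (phi_injective_iff hff (kerι (cotensorMap π lam))).2 (kerι_injective _)
    intro y z h
    apply h1
    apply phiFree_injective hsurj hker
    rw [phiFree_phi_kerι]
    exact (congrArg lam h).trans (phiFree_phi_kerι z).symm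
  · intro v
    obtain ⟨z, hz⟩ := phiFree_surjective (π := π) hsurj (lam v)
    have h1 : ((Phi π).map (cotensorMap π lam)).toLin z = 0 := by
      apply phiFree_injective hsurj hker
      rw [phiFree_phi_cotensorMap, hz, hco, sub_self, map_zero]
    obtain ⟨y, rfl⟩ := ((exact_iff_exact_phi hff _ _).1 (exact_kerι (cotensorMap π lam)) z).1 h1
    exact ⟨y, hlam ((phiFree_phi_kerι y).symm.trans hz)⟩

end Cotensor

end RelBimod

/-! ### The inverse of the antipode of `H`. -/

section AntipodeInverse

variable (hS : Function.Bijective (HopfAlgebra.antipode k : H →ₗ[k] H))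

/-- The antipode as a linear equivalence. -/
def antipodeEquiv : H ≃ₗ[k] H := LinearEquiv.ofBijective _ hS

@[simp] theorem antipodeEquiv_symm_antipode (h : H) :
    (antipodeEquiv hS).symm (HopfAlgebra.antipode k h) = h :=
  LinearEquiv.symm_apply_apply (antipodeEquiv hS) h

@[simp] theorem antipode_antipodeEquiv_symm (h : H) :
    HopfAlgebra.antipode k ((antipodeEquiv hS).symm h) = h :=
  LinearEquiv.apply_symm_apply (antipodeEquiv hS) h

/-- `Δ(S⁻¹(h)) = S⁻¹(h₍₂₎) ⊗ S⁻¹(h₍₁₎)`. -/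
theorem comul_antipodeEquiv_symm (h : H) :
    Coalgebra.comul (R := k) ((antipodeEquiv hS).symm h) =
      TensorProduct.map (antipodeEquiv hS).symm.toLinearMap (antipodeEquiv hS).symm.toLinearMap
        (TensorProduct.comm k H H (Coalgebra.comul (R := k) h)) := by
  obtain ⟨h, rfl⟩ := hS.2 h
  rw [antipodeEquiv_symm_antipode, comul_antipode]
  generalize Coalgebra.comul (R := k) h = z
  induction z with
  | zero => simp
  | add x y hx hy =>
    simp only [map_add]
    rw [← hx, ← hy]
  | tmul a b => simp

theorem counit_antipodeEquiv_symm (h : H) :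
    Coalgebra.counit (R := k) ((antipodeEquiv hS).symm h) = Coalgebra.counit (R := k) h := by
  obtain ⟨h, rfl⟩ := hS.2 h
  rw [antipodeEquiv_symm_antipode, HopfAlgebra.counit_antipode]

end AntipodeInverse

/-! ### From right `H`-comodules to left ones. -/

namespace RelMod

variable (hS : Function.Bijective (HopfAlgebra.antipode k : H →ₗ[k] H))

/-- The left `H`-coaction `v ↦ S⁻¹(v₍₁₎) ⊗ v₍₀₎`. -/
def leftCoact (V : RelMod π) : V.carrier →ₗ[k] H ⊗[k] V.carrier :=
  (antipodeEquiv hS).symm.toLinearMap.rTensor V.carrier ∘ₗ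
    (TensorProduct.comm k V.carrier H).toLinearMap ∘ₗ V.coact

/-- The map `S⁻¹` reverses the comultiplication, and so does moving `H` from the right to the left.
The permutation `Θ` combines both reversals and carries right coassociativity to left
coassociativity. -/
theorem leftCoact_coassoc (V : RelMod π) (v : V.carrier) :
    TensorProduct.assoc k H H V.carrier
      ((Coalgebra.comul (R := k)).rTensor V.carrier (V.leftCoact hS v)) =
      (V.leftCoact hS).lTensor H (V.leftCoact hS v) := by
  let T : H →ₗ[k] H := (antipodeEquiv hS).symm.toLinearMap
  let Θ : V.carrier ⊗[k] (H ⊗[k] H) →ₗ[k] H ⊗[k] (H ⊗[k] V.carrier) :=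
    (TensorProduct.assoc k H H V.carrier).toLinearMap ∘ₗ
      (TensorProduct.map T T ∘ₗ (TensorProduct.comm k H H).toLinearMap).rTensor V.carrier ∘ₗ
      (TensorProduct.comm k V.carrier (H ⊗[k] H)).toLinearMap
  have h1 : ∀ x : V.carrier ⊗[k] H, TensorProduct.assoc k H H V.carrier
      ((Coalgebra.comul (R := k)).rTensor V.carrier
        (T.rTensor V.carrier (TensorProduct.comm k V.carrier H x))) =
      Θ ((Coalgebra.comul (R := k)).lTensor V.carrier x) := by
    intro x
    induction x with
    | zero => simp
    | add x y hx hy => simp only [map_add, hx, hy]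
    | tmul v h =>
      change TensorProduct.assoc k H H V.carrier
        (Coalgebra.comul (R := k) ((antipodeEquiv hS).symm h) ⊗ₜ v) = _
      rw [comul_antipodeEquiv_symm]
      rfl
  have h2 : ∀ x : V.carrier ⊗[k] H, (V.leftCoact hS).lTensor H
      (T.rTensor V.carrier (TensorProduct.comm k V.carrier H x)) =
      Θ (TensorProduct.assoc k V.carrier H H (V.coact.rTensor H x)) := by
    intro x
    induction x with
    | zero => simp
    | add x y hx hy => simp only [map_add, hx, hy]
    | tmul v h =>
      change T h ⊗ₜ[k] (T.rTensor V.carrier (TensorProduct.comm k V.carrier H (V.coact v))) =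
        Θ (TensorProduct.assoc k V.carrier H H (V.coact v ⊗ₜ h))
      generalize V.coact v = y
      induction y with
      | zero => simp
      | add x y hx hy => simp only [map_add, add_tmul, tmul_add, hx, hy]
      | tmul w h' => rfl
  exact (h1 _).trans ((congrArg Θ (V.coassoc v).symm).trans (h2 _).symm)

theorem leftCoact_counit (V : RelMod π) (v : V.carrier) :
    (Coalgebra.counit (R := k)).rTensor V.carrier (V.leftCoact hS v) = 1 ⊗ₜ[k] v := by
  have h1 : ∀ x : V.carrier ⊗[k] H, (Coalgebra.counit (R := k)).rTensor V.carrier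
      ((antipodeEquiv hS).symm.toLinearMap.rTensor V.carrier
        (TensorProduct.comm k V.carrier H x)) =
      TensorProduct.comm k V.carrier k ((Coalgebra.counit (R := k)).lTensor V.carrier x) := by
    intro x
    induction x with
    | zero => simp
    | add x y hx hy => simp only [map_add, hx, hy]
    | tmul v h => simp [counit_antipodeEquiv_symm]
  refine (h1 _).trans ?_
  rw [V.counit]
  rfl

/-- Applying `S` undoes `S⁻¹`, so no information is lost and colinearity may be checked on either
side. -/
theorem coact_eq_leftCoact (V : RelMod π) (v : V.carrier) :
    V.coact v = TensorProduct.comm k H V.carrier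
      ((HopfAlgebra.antipode k).rTensor V.carrier (V.leftCoact hS v)) := by
  change V.coact v = TensorProduct.comm k H V.carrier ((HopfAlgebra.antipode k).rTensor V.carrier
    ((antipodeEquiv hS).symm.toLinearMap.rTensor V.carrier
      (TensorProduct.comm k V.carrier H (V.coact v))))
  generalize V.coact v = x
  induction x with
  | zero => simp
  | add x y hx hy =>
    simp only [map_add]
    rw [← hx, ← hy]
  | tmul v h => simp

/-- A map of left comodules is a map of right comodules. -/
theorem map_coact_of_leftCoact {V W : RelMod π} (p : V.carrier →ₗ[k] W.carrier)
    (h : ∀ v, W.leftCoact hS (p v) = p.lTensor H (V.leftCoact hS v)) (v : V.carrier) :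
    W.coact (p v) = p.rTensor H (V.coact v) := by
  rw [coact_eq_leftCoact hS W, coact_eq_leftCoact hS V, h]
  generalize V.leftCoact hS v = x
  induction x with
  | zero => simp
  | add x y hx hy => simp only [map_add, hx, hy]
  | tmul v h => simp

theorem Hom.map_leftCoact {V W : RelMod π} (p : V ⟶ W) (v : V.carrier) :
    W.leftCoact hS (p.toLin v) = p.toLin.lTensor H (V.leftCoact hS v) := by
  simp only [leftCoact, LinearMap.comp_apply, p.map_coact, LinearEquiv.coe_coe]
  generalize V.coact v = x
  induction x with
  | zero => simp
  | add x y hx hy => simp only [map_add, hx, hy]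
  | tmul v h => simp

end RelMod

namespace RelBimod

/-- The `S⁻¹` cancels the `S` in the coaction of `Φ(E)`, leaving `π(e₍₋₁₎) ⊗ [e₍₀₎]`. This is the
coaction needed for `e₍₋₁₎ ⊗ [e₍₀₎]` to lie in the cotensor product. -/
theorem leftCoact_phi (hS : Function.Bijective (HopfAlgebra.antipode k : H →ₗ[k] H))
    (E : RelBimod π) (e : E.carrier) :
    ((Phi π).obj E).leftCoact hS (phiClass E e) =
      (π : G →ₗ[k] H).rTensor _ (E.coactQ e) := by
  change (antipodeEquiv hS).symm.toLinearMap.rTensor _ (TensorProduct.comm k _ H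
    (TensorProduct.map E.augL.mkQ (antiPi π) (TensorProduct.comm k G E.carrier (E.coact e)))) =
    (π : G →ₗ[k] H).rTensor _ (E.augL.mkQ.lTensor G (E.coact e))
  generalize E.coact e = x
  induction x with
  | zero => simp
  | add x y hx hy => simp only [map_add, hx, hy]
  | tmul g e => simp [antiPi]

/-! ### The unit `E → G □_H Φ(E)` and full faithfulness. -/

section Unit

variable {E F : RelBimod π}

theorem mkQ_ract (hE : isM0 π E) (m : coinv π) (e : E.carrier) :
    E.augL.mkQ (E.ract m e) = epsM π m • E.augL.mkQ e := by
  -- The element `m - ε(m) 1` lies in `M⁺`, so the inclusion `E M⁺ ⊆ M⁺ E` applies to it.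
  have h : E.ract (m - epsM π m • 1) e ∈ E.augL :=
    hE (Submodule.subset_span ⟨_, e, by simp, rfl⟩)
  rw [map_sub, LinearMap.sub_apply, map_smul, LinearMap.smul_apply, E.ract_one] at h
  rw [← map_smul]
  exact (Submodule.Quotient.eq _).2 h

theorem phi_isTrivial (hE : isM0 π E) : isTrivial π ((Phi π).obj E) := by
  intro m v
  obtain ⟨e, rfl⟩ := E.augL.mkQ_surjective v
  exact mkQ_ract hE m e

/-- The condition `E M⁺ ⊆ M⁺ E` enters here: it replaces `[e₍₀₎ m₍₂₎]` by `ε(m₍₂₎) [e₍₀₎]`, so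
`e₍₋₁₎ m₍₁₎ ⊗ [e₍₀₎ m₍₂₎]` collapses to `e₍₋₁₎ m ⊗ [e₍₀₎]`. Without it the target `G ⊗ Φ(E)` would
need a twisted right action. -/
theorem coactQ_ract (hE : isM0 π E) (m : coinv π) (e : E.carrier) :
    E.coactQ (E.ract m e) = (LinearMap.mulRight k (m : G)).rTensor _ (E.coactQ e) := by
  have h : ∀ (t : G ⊗[k] coinv π) (x : G ⊗[k] E.carrier),
      E.augL.mkQ.lTensor G (TensorProduct.map₂ (LinearMap.mul k G).flip E.ract t x) =
      (LinearMap.mulRight k (TensorProduct.rid k G ((epsM π).lTensor G t))).rTensor _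
        (E.augL.mkQ.lTensor G x) := by
    intro t x
    induction x with
    | zero => simp
    | add x y hx hy => simp only [map_add, hx, hy]
    | tmul g e =>
      induction t with
      | zero => simp
      | add x y hx hy =>
        simp only [map_add, LinearMap.add_apply, hx, hy, LinearMap.lTensor_tmul,
          LinearMap.rTensor_tmul, LinearMap.mulRight_apply, mul_add, add_tmul]
      | tmul a m =>
        simp only [map₂_apply_tmul, map_tmul, LinearMap.lTensor_tmul, mkQ_ract hE,
          TensorProduct.rid_tmul, LinearMap.rTensor_tmul, LinearMap.mulRight_apply,
          LinearMap.flip_apply, LinearMap.mul_apply', mul_smul_comm, TensorProduct.tmul_smul,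
          TensorProduct.smul_tmul']
  refine (congrArg _ (E.coact_ract m e)).trans ((h _ _).trans ?_)
  rw [comulM_epsM, TensorProduct.rid_tmul, one_smul]
  rfl

theorem coactQ_coassoc (E : RelBimod π) (e : E.carrier) :
    TensorProduct.assoc k G G _ ((Coalgebra.comul (R := k)).rTensor _ (E.coactQ e)) =
      E.coactQ.lTensor G (E.coact e) := by
  have h : ∀ x : G ⊗[k] E.carrier, TensorProduct.assoc k G G _
      ((Coalgebra.comul (R := k)).rTensor _ (E.augL.mkQ.lTensor G x)) =
      (E.augL.mkQ.lTensor G).lTensor G (TensorProduct.assoc k G G _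
        ((Coalgebra.comul (R := k)).rTensor _ x)) := by
    intro x
    induction x with
    | zero => simp
    | add x y hx hy => simp only [map_add, hx, hy]
    | tmul g e =>
      simp only [LinearMap.rTensor_tmul, LinearMap.lTensor_tmul]
      generalize Coalgebra.comul (R := k) g = z
      induction z with
      | zero => simp
      | add x y hx hy => simp only [map_add, hx, hy, add_tmul]
      | tmul c d => simp
  refine (h _).trans ?_
  rw [E.coassoc]
  exact (LinearMap.lTensor_comp_apply G (E.augL.mkQ.lTensor G) E.coact (E.coact e)).symm

theorem counit_coactQ (E : RelBimod π) (e : E.carrier) :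
    TensorProduct.lid k _ ((Coalgebra.counit (R := k) (A := G)).rTensor _ (E.coactQ e)) =
      phiClass E e := by
  have h : ∀ x : G ⊗[k] E.carrier,
      TensorProduct.lid k _ ((Coalgebra.counit (R := k) (A := G)).rTensor _
        (E.augL.mkQ.lTensor G x)) =
      E.augL.mkQ (TensorProduct.lid k _ ((Coalgebra.counit (R := k) (A := G)).rTensor _ x)) := by
    intro x
    induction x with
    | zero => simp
    | add x y hx hy => simp only [map_add, hx, hy]
    | tmul g e => simp
  refine (h _).trans ?_
  rw [E.counit, TensorProduct.lid_tmul, one_smul]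
  rfl

/-- The morphism `e ↦ e₍₋₁₎ ⊗ [e₍₀₎]`. -/
def unitFree (hE : isM0 π E) : E ⟶ free π ((Phi π).obj E).carrier where
  toLin := E.coactQ
  map_lact := E.coactQ_lact
  map_ract := coactQ_ract hE
  map_coact := E.coactQ_coassoc

variable (hS : Function.Bijective (HopfAlgebra.antipode k : H →ₗ[k] H))

/-- The unit `E → G □_H Φ(E)`. -/
def cotensorUnit (hE : isM0 π E) : E ⟶ cotensor π (((Phi π).obj E).leftCoact hS) :=
  kerLift _ (unitFree hE) (fun e => by
    refine sub_eq_zero.2 ?_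
    let Q := ((Phi π).obj E).carrier
    let q : E.carrier →ₗ[k] Q := phiClass E
    let c : E.carrier →ₗ[k] G ⊗[k] Q := E.coactQ
    let lam : Q →ₗ[k] H ⊗[k] Q := ((Phi π).obj E).leftCoact hS
    -- Both terms of the cotensor condition become `e₍₋₂₎ ⊗ π(e₍₋₁₎) ⊗ [e₍₀₎]`: the first by
    -- coassociativity, the second by `leftCoact_phi`.
    have h1 : ∀ x : G ⊗[k] Q,
        TensorProduct.assoc k G H Q ((homCoact π).toLinearMap.rTensor Q x) =
        ((π : G →ₗ[k] H).rTensor Q).lTensor G (TensorProduct.assoc k G G Q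
          ((Coalgebra.comul (R := k)).rTensor Q x)) := by
      intro x
      induction x with
      | zero => simp
      | add x y hx hy => simp only [map_add, hx, hy]
      | tmul g v =>
        change TensorProduct.assoc k G H Q (TensorProduct.map LinearMap.id (π : G →ₗ[k] H)
          (Coalgebra.comul (R := k) g) ⊗ₜ v) = _
        rw [LinearMap.rTensor_tmul]
        generalize Coalgebra.comul (R := k) g = z
        induction z with
        | zero => simp
        | add x y hx hy => simp only [map_add, add_tmul, hx, hy]
        | tmul a b => simp
    have h2 : ∀ x : G ⊗[k] E.carrier,
        ((π : G →ₗ[k] H).rTensor Q).lTensor G (c.lTensor G x) =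
          lam.lTensor G (q.lTensor G x) := by
      intro x
      induction x with
      | zero => simp
      | add x y hx hy => simp only [map_add, hx, hy]
      | tmul g e =>
        simp only [LinearMap.lTensor_tmul]
        exact congrArg (fun z => g ⊗ₜ[k] z) (leftCoact_phi hS E e).symm
    exact (h1 _).trans ((congrArg _ (E.coactQ_coassoc e)).trans (h2 _)))

/-- A triangle identity, amounting to `ε(e₍₋₁₎) [e₍₀₎] = [e]`. -/
theorem cotensorCounit_cotensorUnit (hE : isM0 π E) (y : ((Phi π).obj E).carrier) :
    cotensorCounit π (((Phi π).obj E).leftCoact hS)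
      (((Phi π).map (cotensorUnit hS hE)).toLin y) = y := by
  obtain ⟨e, rfl⟩ := E.augL.mkQ_surjective y
  exact E.counit_coactQ e

/-- By the triangle identity, `Φ` of the unit is a right inverse of the counit. A right inverse of a
bijection is bijective, and `Φ` reflects injectivity and surjectivity. -/
theorem cotensorUnit_bijective (hff : IsFaithfullyFlat π) (hsurj : Function.Surjective π)
    (hker : LinearMap.ker (π : G →ₗ[k] H) = augG π) (hE : isM0 π E) :
    Function.Bijective (cotensorUnit hS hE).toLin := by
  have h := cotensorCounit_bijective hff hsurj hker
    (((Phi π).obj E).leftCoact_coassoc hS) (((Phi π).obj E).leftCoact_counit hS)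
  refine ⟨(phi_injective_iff hff _).1 ?_, (phi_surjective_iff hff _).1 ?_⟩
  · exact Function.LeftInverse.injective (cotensorCounit_cotensorUnit hS hE)
  · intro y
    -- Injectivity of the counit turns its right inverse into a two-sided one.
    exact ⟨_, h.1 (cotensorCounit_cotensorUnit hS hE (cotensorCounit π _ y))⟩

/-- The functoriality of the cotensor product. -/
def cotensorHom {V W : RelMod π} (p : V ⟶ W) :
    cotensor π (V.leftCoact hS) ⟶ cotensor π (W.leftCoact hS) :=
  kerLift _ (kerι (cotensorMap π (V.leftCoact hS)) ≫ freeMap π p.toLin) (by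
    rintro ⟨x, hx⟩
    have hx' : (cotensorMap π (V.leftCoact hS)).toLin x = 0 := hx
    have h : ∀ x : G ⊗[k] V.carrier,
        (cotensorMap π (W.leftCoact hS)).toLin (p.toLin.lTensor G x) =
        (p.toLin.lTensor H).lTensor G ((cotensorMap π (V.leftCoact hS)).toLin x) := by
      intro x
      rw [cotensorMap_apply, cotensorMap_apply, map_sub]
      congr 1
      · induction x with
        | zero => simp
        | add x y hx hy => simp only [map_add, hx, hy]
        | tmul g v =>
          simp only [LinearMap.lTensor_tmul, LinearMap.rTensor_tmul]
          generalize (homCoact π).toLinearMap g = z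
          induction z with
          | zero => simp
          | add x y hx hy => simp only [map_add, add_tmul, hx, hy]
          | tmul a b => simp
      · induction x with
        | zero => simp
        | add x y hx hy => simp only [map_add, hx, hy]
        | tmul g v => simp [p.map_leftCoact hS]
    exact (h x).trans ((congrArg _ hx').trans (map_zero _)))

theorem coactQ_map (f : E ⟶ F) (e : E.carrier) :
    F.coactQ (f.toLin e) = ((Phi π).map f).toLin.lTensor G (E.coactQ e) := by
  let p : (E.carrier ⧸ E.augL) →ₗ[k] (F.carrier ⧸ F.augL) := ((Phi π).map f).toLin
  change F.augL.mkQ.lTensor G (F.coact (f.toLin e)) =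
    p.lTensor G (E.augL.mkQ.lTensor G (E.coact e))
  rw [f.map_coact]
  generalize E.coact e = x
  induction x with
  | zero => simp
  | add x y hx hy => simp only [map_add, hx, hy]
  | tmul h e => rfl

/-- By naturality, `Φ(f)` determines `coactQ (f e)`; this element is the image of `f e` under the
unit of `F`, which is injective. -/
theorem phi_map_injective (hff : IsFaithfullyFlat π) (hsurj : Function.Surjective π)
    (hker : LinearMap.ker (π : G →ₗ[k] H) = augG π)
    (hS : Function.Bijective (HopfAlgebra.antipode k : H →ₗ[k] H)) (hF : isM0 π F) {f g : E ⟶ F}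
    (h : (Phi π).map f = (Phi π).map g) : f = g := by
  refine hom_ext fun e => (cotensorUnit_bijective hS hff hsurj hker hF).1 (Subtype.ext ?_)
  exact (coactQ_map f e).trans ((congrArg
    (fun p => (RelMod.Hom.toLin p).lTensor G (E.coactQ e)) h).trans (coactQ_map g e).symm)

/-- The preimage of `p` is the unit of `E`, followed by `G □_H p`, followed by the inverse of the
unit of `F`. Applying `ε` to the first leg of `coactQ (f e) = (G ⊗ p)(coactQ e)` recovers `[f e] = p
[e]`. -/
theorem phi_map_surjective (hff : IsFaithfullyFlat π) (hsurj : Function.Surjective π)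
    (hker : LinearMap.ker (π : G →ₗ[k] H) = augG π)
    (hS : Function.Bijective (HopfAlgebra.antipode k : H →ₗ[k] H)) (hE : isM0 π E) (hF : isM0 π F)
    (p : (Phi π).obj E ⟶ (Phi π).obj F) : ∃ f : E ⟶ F, (Phi π).map f = p := by
  let i := isoOfBijective (cotensorUnit hS hF) (cotensorUnit_bijective hS hff hsurj hker hF)
  let f : E ⟶ F := cotensorUnit hS hE ≫ cotensorHom hS p ≫ i.inv
  refine ⟨f, RelMod.hom_ext fun v => ?_⟩
  obtain ⟨e, rfl⟩ := E.augL.mkQ_surjective v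
  have h1 : f ≫ i.hom = cotensorUnit hS hE ≫ cotensorHom hS p := by simp [f]
  let P : (E.carrier ⧸ E.augL) →ₗ[k] (F.carrier ⧸ F.augL) := p.toLin
  have h2 : F.coactQ (f.toLin e) = P.lTensor G (E.coactQ e) :=
    congrArg (fun q => (kerι _).toLin (Hom.toLin q e)) h1
  have h3 : ∀ x, TensorProduct.lid k _ ((Coalgebra.counit (R := k) (A := G)).rTensor _
      (P.lTensor G x)) =
      P (TensorProduct.lid k _ ((Coalgebra.counit (R := k) (A := G)).rTensor _ x)) := by
    intro x
    induction x with
    | zero => simp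
    | add x y hx hy => simp only [map_add, hx, hy]
    | tmul g e => simp
  have h4 := F.counit_coactQ (f.toLin e)
  rw [h2, h3] at h4
  exact h4.symm.trans (congrArg P (E.counit_coactQ e))

end Unit

/-! ### Essential surjectivity. -/

section EssSurj

variable (hS : Function.Bijective (HopfAlgebra.antipode k : H →ₗ[k] H)) (V : RelMod π)

/-- This is `ε(g m) v = ε(m) ε(g) v`: right multiplication on `G` becomes the trivial action after
applying the counit. -/
theorem cotensorCounit_ract (m : coinv π) (x : (cotensor π (V.leftCoact hS)).carrier) :
    cotensorCounit π (V.leftCoact hS)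
      (phiClass _ ((cotensor π (V.leftCoact hS)).ract m x)) =
    epsM π m • cotensorCounit π (V.leftCoact hS) (phiClass _ x) := by
  obtain ⟨x, hx⟩ := x
  change TensorProduct.lid k _ ((Coalgebra.counit (R := k) (A := G)).rTensor _
      ((LinearMap.mulRight k (m : G)).rTensor V.carrier x)) =
    epsM π m • TensorProduct.lid k _ ((Coalgebra.counit (R := k) (A := G)).rTensor _ x)
  clear hx
  induction x using TensorProduct.induction_on with
  | zero => simp
  | add x y hx hy => simp only [map_add, smul_add, hx, hy]
  | tmul g v => simp [smul_smul, mul_comm]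

/-- On the cotensor product, `λ(ε(g) v) = π(g) ⊗ v = π(g₍₁₎) ⊗ ε(g₍₂₎) v`, and the last expression
is the coaction of `Φ(G □_H V)` followed by the counit map. -/
theorem cotensorCounit_leftCoact
    (y : ((Phi π).obj (cotensor π (V.leftCoact hS))).carrier) :
    V.leftCoact hS (cotensorCounit π (V.leftCoact hS) y) =
      (cotensorCounit π (V.leftCoact hS)).lTensor H
        (((Phi π).obj (cotensor π (V.leftCoact hS))).leftCoact hS y) := by
  rw [← phiFree_phi_kerι]
  obtain ⟨x, rfl⟩ := (cotensor π (V.leftCoact hS)).augL.mkQ_surjective y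
  refine Eq.trans ?_ (congrArg _ (leftCoact_phi hS _ x).symm)
  let X := (cotensor π (V.leftCoact hS)).carrier
  let Q := ((Phi π).obj (cotensor π (V.leftCoact hS))).carrier
  let ι : X →ₗ[k] G ⊗[k] V.carrier := (kerι (cotensorMap π (V.leftCoact hS))).toLin
  let q : X →ₗ[k] Q := phiClass (cotensor π (V.leftCoact hS))
  let ε : G ⊗[k] V.carrier →ₗ[k] V.carrier := (TensorProduct.lid k V.carrier).toLinearMap ∘ₗ
      (Coalgebra.counit (R := k) (A := G)).rTensor V.carrier
  have h1 : ∀ z : G ⊗[k] X,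
      (cotensorCounit π (V.leftCoact hS)).lTensor H ((π : G →ₗ[k] H).rTensor Q
        (q.lTensor G z)) = ε.lTensor H ((π : G →ₗ[k] H).rTensor _ (ι.lTensor G z)) := by
    intro z
    induction z with
    | zero => simp
    | add x y hx hy => simp only [map_add, hx, hy]
    | tmul g x => rfl
  -- The counit axiom `g = g₍₁₎ ε(g₍₂₎)` is inserted to bring in the coaction of the cotensor
  -- product.
  have h2 : ∀ z : G ⊗[k] V.carrier, (π : G →ₗ[k] H).rTensor _ z =
      ε.lTensor H ((π : G →ₗ[k] H).rTensor _ (TensorProduct.assoc k G G V.carrier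
        ((Coalgebra.comul (R := k)).rTensor _ z))) := by
    intro z
    induction z with
    | zero => simp
    | add x y hx hy =>
      simp only [map_add]
      rw [← hx, ← hy]
    | tmul g v =>
      have h3 : ∀ w : G ⊗[k] G, ε.lTensor H ((π : G →ₗ[k] H).rTensor _
          (TensorProduct.assoc k G G V.carrier (w ⊗ₜ v))) =
          (π : G →ₗ[k] H) (TensorProduct.rid k G
            ((Coalgebra.counit (R := k) (A := G)).lTensor G w)) ⊗ₜ v := by
        intro w
        induction w with
        | zero => simp
        | add x y hx hy => simp only [map_add, add_tmul, hx, hy]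
        | tmul a b => simp [ε, TensorProduct.smul_tmul', TensorProduct.tmul_smul]
      rw [LinearMap.rTensor_tmul, LinearMap.rTensor_tmul, h3, Coalgebra.lTensor_counit_comul]
      simp
  refine Eq.trans ?_ (h1 ((cotensor π (V.leftCoact hS)).coact x)).symm
  exact (h2 (ι x)).trans (congrArg (fun z => ε.lTensor H ((π : G →ₗ[k] H).rTensor _ z))
    ((kerι (cotensorMap π (V.leftCoact hS))).map_coact x))

variable {V}

/-- For `ε(m) = 0` the counit sends `[x m]` to `0`; its injectivity then forces `[x m] = 0`, that
is, `x m ∈ M⁺ (G □_H V)`. -/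
theorem cotensor_isM0 (hinj : Function.Injective (cotensorCounit π (V.leftCoact hS))) :
    isM0 π (cotensor π (V.leftCoact hS)) := by
  refine Submodule.span_le.2 ?_
  rintro _ ⟨m, x, hm, rfl⟩
  refine (Submodule.Quotient.mk_eq_zero _).1 (hinj ?_)
  exact (cotensorCounit_ract hS V m x).trans (by
    rw [hm, zero_smul]
    exact (map_zero (cotensorCounit π (V.leftCoact hS))).symm)

/-- The counit `Φ(G □_H V) ≅ V`. -/
def cotensorCounitIso (hV : isTrivial π V)
    (hbij : Function.Bijective (cotensorCounit π (V.leftCoact hS))) :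
    (Phi π).obj (cotensor π (V.leftCoact hS)) ≅ V :=
  RelMod.mkIso
    { toLin := cotensorCounit π (V.leftCoact hS)
      map_ract := fun m y => by
        obtain ⟨x, rfl⟩ := (cotensor π (V.leftCoact hS)).augL.mkQ_surjective y
        exact (cotensorCounit_ract hS V m x).trans (hV _ _).symm
      map_coact := RelMod.map_coact_of_leftCoact hS _ (cotensorCounit_leftCoact hS V) }
    (LinearEquiv.ofBijective _ hbij).symm.toLinearMap
    (fun e => LinearEquiv.symm_apply_apply (LinearEquiv.ofBijective _ hbij) e)
    (fun x => LinearEquiv.apply_symm_apply (LinearEquiv.ofBijective _ hbij) x)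

end EssSurj

end RelBimod

/-! ### The restricted functor is an equivalence. -/

theorem isM0_le_inverseImage : isM0 π ≤ (isTrivial π).inverseImage (Phi π) :=
  fun _ hE => RelBimod.phi_isTrivial hE

theorem phiRestr_isEquivalence (hff : IsFaithfullyFlat π) (hsurj : Function.Surjective π)
    (hker : LinearMap.ker (π : G →ₗ[k] H) = augG π)
    (hS : Function.Bijective (HopfAlgebra.antipode k : H →ₗ[k] H))
    (h : isM0 π ≤ (isTrivial π).inverseImage (Phi π)) : (PhiRestr h).IsEquivalence where
  faithful := ⟨fun {_ F _ _} hfg => ObjectProperty.hom_ext _ <|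
    RelBimod.phi_map_injective hff hsurj hker hS F.property (congrArg (fun q => q.hom) hfg)⟩
  full := ⟨fun {E F} p => by
    obtain ⟨f, hf⟩ := RelBimod.phi_map_surjective hff hsurj hker hS E.property F.property p.hom
    exact ⟨ObjectProperty.homMk f, ObjectProperty.hom_ext _ hf⟩⟩
  essSurj := ⟨fun V => by
    have hb := RelBimod.cotensorCounit_bijective hff hsurj hker
      (V.obj.leftCoact_coassoc hS) (V.obj.leftCoact_counit hS)
    exact ⟨⟨RelBimod.cotensor π (V.obj.leftCoact hS), RelBimod.cotensor_isM0 hS hb.1⟩,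
      ⟨(isTrivial π).isoMk (RelBimod.cotensorCounitIso hS V.property hb)⟩⟩⟩

namespace RelBimod

/-! ### Compatibility of `Φ` with tensor products and units. -/

section Tensor

variable {E F : RelBimod π}

/-- The map `Φ(E ⊗_M F) → Φ(E) ⊗ Φ(F)`, `[e ⊗_M f] ↦ [e] ⊗ [f]`. -/
def phiTens (hE : isM0 π E) : (Tens E F ⧸ (tens E F).augL) →ₗ[k]
    (E.carrier ⧸ E.augL) ⊗[k] (F.carrier ⧸ F.augL) :=
  (tens E F).augL.liftQ (BalancedTensor.lift
    ((TensorProduct.mk k _ _).compl₁₂ E.augL.mkQ F.augL.mkQ) (fun m e f => by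
      simp only [LinearMap.compl₁₂_apply, mkQ_ract hE, mkQ_lact, map_smul, LinearMap.smul_apply]))
    (by
      refine Submodule.span_le.2 ?_
      rintro _ ⟨m, x, hm, rfl⟩
      obtain ⟨x, rfl⟩ : ∃ y : Tens E F, y = x := ⟨x, rfl⟩
      refine tens_induction (p := fun x => tensLact E F m x ∈ LinearMap.ker _)
        (fun e f => ?_) (fun x y hx hy => ?_) x
      · change E.augL.mkQ (E.lact m e) ⊗ₜ[k] F.augL.mkQ f = 0
        rw [mkQ_lact, hm, zero_smul, zero_tmul]
      · rw [map_add]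
        exact add_mem hx hy)

/-- The map `Φ(E) ⊗ Φ(F) → Φ(E ⊗_M F)`, `[e] ⊗ [f] ↦ [e ⊗_M f]`. -/
def phiTensInv (hE : isM0 π E) : (E.carrier ⧸ E.augL) ⊗[k] (F.carrier ⧸ F.augL) →ₗ[k]
    (Tens E F ⧸ (tens E F).augL) :=
  let b : E.carrier →ₗ[k] F.carrier →ₗ[k] (Tens E F ⧸ (tens E F).augL) :=
    (tmk E F).compr₂ (tens E F).augL.mkQ
  have hl : ∀ m e f, b (E.lact m e) f = epsM π m • b e f := fun m e f =>
    (tens E F).mkQ_lact m (tmk E F e f)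
  have hb : E.augL ≤ LinearMap.ker b := by
    refine Submodule.span_le.2 ?_
    rintro _ ⟨m, e, hm, rfl⟩
    refine LinearMap.ext fun f => ?_
    rw [hl, hm, zero_smul, LinearMap.zero_apply]
  TensorProduct.lift (F.augL.liftQ (E.augL.liftQ b hb).flip (by
    refine Submodule.span_le.2 ?_
    rintro _ ⟨m, f, hm, rfl⟩
    refine Submodule.linearMap_qext _ (LinearMap.ext fun e => ?_)
    change b e (F.lact m f) = 0
    -- Move `m` across `⊗_M`; then `e m` lies in `E M⁺ ⊆ M⁺ E`, where `b` already vanishes.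
    have h1 : b e (F.lact m f) = b (E.ract m e) f :=
      congrArg (tens E F).augL.mkQ (tmk_balanced E F m e f).symm
    have h2 : b (E.ract m e) = 0 := hb (hE (Submodule.subset_span ⟨m, e, hm, rfl⟩))
    rw [h1, h2, LinearMap.zero_apply])).flip

theorem phi_tens_induction {p : (Tens E F ⧸ (tens E F).augL) → Prop}
    (h : ∀ e f, p ((tens E F).augL.mkQ (tmk E F e f)))
    (hadd : ∀ x y, p x → p y → p (x + y)) (y : Tens E F ⧸ (tens E F).augL) : p y := by
  obtain ⟨x, rfl⟩ := (tens E F).augL.mkQ_surjective y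
  refine tens_induction (p := fun x => p ((tens E F).augL.mkQ x)) h (fun x y hx hy => ?_) x
  rw [map_add]
  exact hadd _ _ hx hy

/-- The coaction on `E ⊗_M F` involves `e₍₋₁₎ f₍₋₁₎`, and `S ∘ π` reverses this product to
`S(π(f₍₋₁₎)) S(π(e₍₋₁₎))`. This is exactly the order used in the coaction on a tensor product of
right comodules. -/
theorem phiTens_coact (hE : isM0 π E) (e : E.carrier) (f : F.carrier) :
    RelMod.coMul ((Phi π).obj E) ((Phi π).obj F) (E.preCoact e) (F.preCoact f) =
      (phiTens hE).rTensor H ((tens E F).preCoact (tmk E F e f)) := by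
  have h : ∀ (x : G ⊗[k] E.carrier) (y : G ⊗[k] F.carrier),
      TensorProduct.map₂ (TensorProduct.mk k (E.carrier ⧸ E.augL) (F.carrier ⧸ F.augL))
        (LinearMap.mul k H).flip
        (TensorProduct.map E.augL.mkQ (antiPi π) (TensorProduct.comm k G E.carrier x))
        (TensorProduct.map F.augL.mkQ (antiPi π) (TensorProduct.comm k G F.carrier y)) =
      (phiTens hE).rTensor H (TensorProduct.map (tens E F).augL.mkQ (antiPi π)
        (TensorProduct.comm k G (Tens E F) (coMul E F x y))) := by
    intro x y
    induction x with
    | zero => simp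
    | add x y hx hy => simp only [map_add, LinearMap.add_apply, hx, hy]
    | tmul g e =>
    induction y with
    | zero => simp
    | add x y hx hy => simp only [map_add, hx, hy]
    | tmul h f =>
      simp only [TensorProduct.comm_tmul, map_tmul, map₂_apply_tmul, LinearMap.flip_apply,
        LinearMap.mul_apply', antiPi_mul, LinearMap.rTensor_tmul, TensorProduct.mk_apply]
      rfl
  exact h _ _

/-- The isomorphism `Φ(E ⊗_M F) ≅ Φ(E) ⊗ Φ(F)`. -/
def phiTensIso (hE : isM0 π E) (hF : isM0 π F) :
    (Phi π).obj (tens E F) ≅ RelMod.tens ((Phi π).obj E) ((Phi π).obj F) :=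
  RelMod.mkIso
    { toLin := phiTens hE
      map_ract := fun m => phi_tens_induction
        (fun e f => by
          -- The tensor product of comodules carries the trivial action by definition, so the
          -- condition on `F` is what matches it with `e ⊗_M f m`.
          change E.augL.mkQ e ⊗ₜ[k] F.augL.mkQ (F.ract m f) =
            epsM π m • E.augL.mkQ e ⊗ₜ[k] F.augL.mkQ f
          rw [mkQ_ract hF, TensorProduct.tmul_smul])
        (fun x y hx hy => (map_add ((phiTens hE).comp (((Phi π).obj (tens E F)).ract m)) x y).trans
          ((congrArg₂ (· + ·) hx hy).trans
            (map_add ((RelMod.trivRact π _ m).comp (phiTens hE)) x y).symm))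
      map_coact := phi_tens_induction
        (fun e f => phiTens_coact hE e f)
        (fun x y hx hy => (map_add ((RelMod.tensCoact ((Phi π).obj E) ((Phi π).obj F)).comp
            (phiTens hE)) x y).trans ((congrArg₂ (· + ·) hx hy).trans
          (map_add (((phiTens hE).rTensor H).comp ((Phi π).obj (tens E F)).coact) x y).symm)) }
    (phiTensInv hE)
    (phi_tens_induction (fun e f => rfl) (fun x y hx hy =>
      (map_add ((phiTensInv hE).comp (phiTens hE)) x y).trans (congrArg₂ (· + ·) hx hy)))
    (fun z => by
      have : (phiTens (F := F) hE).comp (phiTensInv hE) = LinearMap.id :=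
        TensorProduct.ext' fun v w => by
          obtain ⟨e, rfl⟩ := E.augL.mkQ_surjective v
          obtain ⟨f, rfl⟩ := F.augL.mkQ_surjective w
          rfl
      exact LinearMap.congr_fun this z)

variable (π) in
/-- The map `Φ(M) → k`, `[m] ↦ ε(m)`. -/
def phiUnit : (coinv π ⧸ (unitObj π).augL) →ₗ[k] ULift.{u} k :=
  ULift.moduleEquiv.symm.toLinearMap ∘ₗ (unitObj π).augL.liftQ (epsM π) (by
    refine Submodule.span_le.2 ?_
    rintro _ ⟨m, n, hm, rfl⟩
    exact (epsM_mul π m n).trans (by rw [hm, zero_mul]))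

/-- Applying `[m] ↦ ε(m)` to the coaction on `Φ(M)` gives `ε(n₍₂₎) S(π(n₍₁₎)) = S(π(n))`, which is
`ε(n) 1` because `π` is scalar on `M`. -/
theorem phiUnit_coact (n : coinv π) :
    (ULift.up (epsM π n) : ULift.{u} k) ⊗ₜ[k] (1 : H) =
      (phiUnit π).rTensor H ((unitObj π).preCoact n) := by
  have h : ∀ t : G ⊗[k] coinv π, (phiUnit π).rTensor H
      (TensorProduct.map (unitObj π).augL.mkQ (antiPi π) (TensorProduct.comm k G (coinv π) t)) =
      (ULift.up 1 : ULift.{u} k) ⊗ₜ[k]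
        antiPi π (TensorProduct.rid k G ((epsM π).lTensor G t)) := by
    intro t
    induction t with
    | zero => simp
    | add x y hx hy => simp only [map_add, tmul_add, hx, hy]
    | tmul g m =>
      have hm : phiUnit π ((unitObj π).augL.mkQ m) = epsM π m • (ULift.up 1 : ULift.{u} k) :=
        ULift.ext _ _ (mul_one (epsM π m)).symm
      rw [TensorProduct.comm_tmul, map_tmul, LinearMap.rTensor_tmul, hm, LinearMap.lTensor_tmul,
        TensorProduct.rid_tmul, map_smul, TensorProduct.smul_tmul]
  refine Eq.trans ?_ (h (comulM π n)).symm
  rw [comulM_epsM, TensorProduct.rid_tmul, one_smul, antiPi_coinv,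
    Algebra.algebraMap_eq_smul_one, ← TensorProduct.smul_tmul]
  congr 1
  exact ULift.ext _ _ (mul_one (epsM π n)).symm

variable (π) in
/-- The isomorphism `Φ(M) ≅ k`, `[m] ↦ ε(m)`. -/
def phiUnitIso : (Phi π).obj (unitObj π) ≅ RelMod.unitObj π :=
  RelMod.mkIso
    { toLin := phiUnit π
      map_ract := fun m v => by
        obtain ⟨n, rfl⟩ := (unitObj π).augL.mkQ_surjective v
        refine ULift.ext _ _ ?_
        exact (epsM_mul π n m).trans (mul_comm _ _)
      map_coact := fun v => by
        obtain ⟨n, rfl⟩ := (unitObj π).augL.mkQ_surjective v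
        exact phiUnit_coact n }
    (LinearMap.toSpanSingleton k _ ((unitObj π).augL.mkQ (1 : coinv π)) ∘ₗ
      ULift.moduleEquiv.toLinearMap)
    (fun v => by
      obtain ⟨n, rfl⟩ := (unitObj π).augL.mkQ_surjective v
      refine ((unitObj π).mkQ_lact n (1 : coinv π)).symm.trans ?_
      exact congrArg (unitObj π).augL.mkQ (mul_one n))
    (fun c => ULift.ext _ _ <| by
      change epsM π (c.down • (1 : coinv π)) = c.down
      simp)

end Tensor

end RelBimod

/-! ### The monoidal equivalence. -/

open RelBimod in
/-- The monoidal structure of the restriction of `Φ`. -/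
def phiRestrCoreMonoidal (h : isM0 π ≤ (isTrivial π).inverseImage (Phi π)) :
    (PhiRestr h).CoreMonoidal :=
  .mk' ((isTrivial π).isoMk (phiUnitIso π).symm)
    (fun E F => (isTrivial π).isoMk (phiTensIso E.property F.property).symm)
    -- The coherence conditions compare maps out of quotients `Φ(-)`, so they are checked on classes
    -- of representatives. The unit conditions moreover use `ε(1) = 1`.
    (fun f F => RelMod.sub_ext <| Submodule.linearMap_qext _ <|
      BalancedTensor.hom_ext fun _ _ => rfl)
    (fun F f => RelMod.sub_ext <| Submodule.linearMap_qext _ <|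
      BalancedTensor.hom_ext fun _ _ => rfl)
    (fun E F K => RelMod.sub_ext <| Submodule.linearMap_qext _ <| LinearMap.ext <|
      tens_induction₃ (fun _ _ _ => rfl) (fun x y hx hy => by simp only [map_add, hx, hy]))
    (fun E => RelMod.sub_ext <| Submodule.linearMap_qext _ <| LinearMap.ext fun e => by
      exact congrArg (fun c => (ULift.up c : ULift.{u} k) ⊗ₜ[k] E.obj.augL.mkQ e)
        (epsM_one π).symm)
    (fun E => RelMod.sub_ext <| Submodule.linearMap_qext _ <| LinearMap.ext fun e => by
      exact congrArg (fun c => E.obj.augL.mkQ e ⊗ₜ[k] (ULift.up c : ULift.{u} k))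
        (epsM_one π).symm)

end

end QHS

/-- The map `[e ⊗_M f] ↦ [e] ⊗ [f]` points out of `Φ(E ⊗_M F)`, so it is the oplax structure map
`δ`, the inverse of the tensorator `μ` of the strong monoidal structure. The formula pins the
abstract structure down to the explicit one. -/
theorem mainTheorem2 {G H : Type u} [Ring G] [HopfAlgebra ℂ G] [Ring H] [HopfAlgebra ℂ H]
    (π : G →ₐc[ℂ] H) (hff : QHS.IsFaithfullyFlat π)
    (hsurj : Function.Surjective π) (hker : LinearMap.ker (π : G →ₗ[ℂ] H) = QHS.augG π)
    (hS : Function.Bijective (HopfAlgebra.antipode ℂ : H →ₗ[ℂ] H)) :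
    ∃ h : QHS.isM0 π ≤ (QHS.isTrivial π).inverseImage (QHS.Phi π),
      (QHS.PhiRestr h).IsEquivalence ∧
      ∃ _ : (QHS.PhiRestr h).Monoidal, ∀ (E F : (QHS.isM0 π).FullSubcategory)
        (e : E.obj.carrier) (f : F.obj.carrier),
        (Functor.OplaxMonoidal.δ (QHS.PhiRestr h) E F).hom.toLin
          (QHS.phiClass (QHS.RelBimod.tens E.obj F.obj) (QHS.RelBimod.tmk E.obj F.obj e f)) =
        QHS.phiClass E.obj e ⊗ₜ[ℂ] QHS.phiClass F.obj f :=
  ⟨QHS.isM0_le_inverseImage, QHS.phiRestr_isEquivalence hff hsurj hker hS _,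
    (QHS.phiRestrCoreMonoidal _).toMonoidal, fun _ _ _ _ => rfl⟩
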